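/- Let $\mathcal H_A=\mathbb C^{d_A}$, $\mathcal H_B=\mathbb C^{d_B}$, let $\Psi\in\mathcal H_A\otimes\mathcal H_B$ be a unit vector, let $\lambda_i$ be the eigenvalues of $\operatorname{Tr}_B|\Psi\rangle\langle\Psi|$ (the squared Schmidt coefficients of $\Psi$, padded by zeros), and for $\alpha\ge 0$, $\alpha\neq1$, let $H_\alpha(\Psi)=\frac1{1-\alpha}\log\sum_{i:\lambda_i\neq0}\lambda_i^{\alpha}$. Let $\rho_{mix}=I/(d_Ad_B)$. For a class $C$ of two-valued POVMs $\{T,I-T\}$ on the bipartite system $\mathcal H_A^{\otimes n}\otimes\mathcal H_B^{\otimes n}$ put $$\beta_{n,C}(\alpha|\Psi\|\rho_{mix})=\inf\bigl\{\operatorname{Tr}\rho_{mix}^{\otimes n}(I-T)\ :\ \{T,I-T\}\in C,\ \operatorname{Tr}\,|\Psi\rangle\langle\Psi|^{\otimes n}\,T\le\alpha\bigr\}.$$ Let $\leftrightarrow,k$ be the class of POVMs implemented by LOCC protocols with $k$ rounds of classical communication ($k+1$ alternating local steps, Alice acting first, finitely many outcomes in each step); let $\rightarrow$ be the class $\leftrightarrow,1$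 of one-way LOCC POVMs, let $\leftrightarrow$ be the closure of $\bigcup_k(\leftrightarrow,k)$ (general two-way LOCC), and let $sep$ be the class of POVMs both of whose elements are finite sums $\sum_j A_j\otimes B_j$ with $A_j,B_j\ge0$. Then for every $r>0$ the limits $\lim_{n\to\infty}-\frac1n\log\beta_{n,C}(e^{-nr}|\Psi\|\rho_{mix})$ exist for $C=(\leftrightarrow,2)$, $C=\;\leftrightarrow$ and $C=sep$, and all three are equal to $$\sup_{0\le s<1}\Bigl[\frac{-2s}{1-s}\,r-H_{\frac{1+s}2}(\Psi)\Bigr]+\log d_Ad_B .$$ The limit also exists for one-way LOCC, $C=\;\rightarrow$, and the value above is strictly larger than the one-way limit if and only if the nonzero $\lambda_i$ are not all equal. In particular, if all $\min(d_A,d_B)$ Schmidt coefficients of $\Psi$ are nonzero, it is strictly larger unless $\Psi$ is maximally entangled. -/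

import Mathlib

open scoped Kronecker Matrix ComplexOrder

namespace LocalTesting

noncomputable section

/-- The pure density matrix `|Ψ⟩⟨Ψ|`. -/
def pureState {ι : Type} (Ψ : EuclideanSpace ℂ ι) : Matrix ι ι ℂ :=
  Matrix.of fun x y => Ψ x * star (Ψ y)

/-- The completely mixed state `I / (d_A d_B)`. -/
def mixedState (dA dB : ℕ) : Matrix (Fin dA × Fin dB) (Fin dA × Fin dB) ℂ :=
  ((dA : ℂ) * (dB : ℂ))⁻¹ • 1

/-- The `n`-fold tensor power of an operator on `H_A ⊗ H_B`, regarded as an operator on the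
bipartite space `H_A^{⊗ n} ⊗ H_B^{⊗ n}`. -/
def copies {ι κ : Type} (n : ℕ) (ρ : Matrix (ι × κ) (ι × κ) ℂ) :
    Matrix ((Fin n → ι) × (Fin n → κ)) ((Fin n → ι) × (Fin n → κ)) ℂ :=
  Matrix.of fun x y => ∏ k, ρ (x.1 k, x.2 k) (y.1 k, y.2 k)

/-- The reduced density matrix `Tr_B |Ψ⟩⟨Ψ|`. -/
def reducedState {ι κ : Type} [Fintype κ] (Ψ : EuclideanSpace ℂ (ι × κ)) : Matrix ι ι ℂ :=
  Matrix.of fun a a' => ∑ b, pureState Ψ (a, b) (a', b)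

theorem reducedState_isHermitian {ι κ : Type} [Fintype κ] (Ψ : EuclideanSpace ℂ (ι × κ)) :
    (reducedState Ψ).IsHermitian := by
  ext a a'
  simp [reducedState, pureState, Matrix.conjTranspose_apply, mul_comm]

/-- The squared Schmidt coefficients `λ_i` of `Ψ`, padded by zeros: the eigenvalues, with
multiplicity, of the reduced density matrix. -/
def schmidt {ι κ : Type} [Fintype ι] [DecidableEq ι] [Fintype κ]
    (Ψ : EuclideanSpace ℂ (ι × κ)) : ι → ℝ :=
  (reducedState_isHermitian Ψ).eigenvalues

/-- The Rényi entropy `H_α(Ψ) = (1 - α)⁻¹ log ∑_i λ_i ^ α`, for orders `α ≠ 1`; the sum is over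
the nonzero `λ_i`. -/
def renyiEntropy {ι κ : Type} [Fintype ι] [DecidableEq ι] [Fintype κ]
    (α : ℝ) (Ψ : EuclideanSpace ℂ (ι × κ)) : ℝ :=
  Real.log (∑ i with schmidt Ψ i ≠ 0, schmidt Ψ i ^ α) / (1 - α)

/-- All nonzero Schmidt coefficients of `Ψ` are equal: `Ψ` is maximally entangled between the
supports of its two reduced states. -/
def IsFlat {ι κ : Type} [Fintype ι] [DecidableEq ι] [Fintype κ]
    (Ψ : EuclideanSpace ℂ (ι × κ)) : Prop :=
  ∀ i j, schmidt Ψ i ≠ 0 → schmidt Ψ j ≠ 0 → schmidt Ψ i = schmidt Ψ j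

/-- Separable (unnormalized) positive operators: finite sums of `A ⊗ B` with `A, B ≥ 0`. -/
def IsSeparable {ι κ : Type} (T : Matrix (ι × κ) (ι × κ) ℂ) : Prop :=
  ∃ (m : ℕ) (A : Fin m → Matrix ι ι ℂ) (B : Fin m → Matrix κ κ ℂ),
    (∀ i, (A i).PosSemidef) ∧ (∀ i, (B i).PosSemidef) ∧ T = ∑ i, A i ⊗ₖ B i

/-- `IsLOCC k ι κ T`: the two-valued POVM `{T, I - T}` is implemented by an LOCC protocol with
`k` rounds of classical communication (hence `k + 1` local steps, alternating between the
parties), in which the party holding the first system acts first. For `k = 0` this party makes a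
local two-valued measurement `{M, I - M}`. For `k + 1` rounds it makes a local measurement with
finitely many outcomes `i` and Kraus operators `K i` (whose output spaces `ι' i` are arbitrary
finite-dimensional), sends `i` to the other party, and the two continue with a `k`-round protocol
`S i`, chosen depending on `i`, in which the other party acts first. -/
def IsLOCC : ℕ → ∀ (ι κ : Type) [Fintype ι] [DecidableEq ι] [Fintype κ] [DecidableEq κ],
    Matrix (ι × κ) (ι × κ) ℂ → Prop
  | 0, ι, κ, _, _, _, _, T =>
      ∃ M : Matrix ι ι ℂ, M.PosSemidef ∧ (1 - M).PosSemidef ∧ T = M ⊗ₖ (1 : Matrix κ κ ℂ)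
  | k + 1, ι, κ, _, _, _, _, T =>
      ∃ (m : ℕ) (ι' : Fin m → Type) (_ : ∀ i, Fintype (ι' i)) (_ : ∀ i, DecidableEq (ι' i))
        (K : ∀ i, Matrix (ι' i) ι ℂ) (S : ∀ i, Matrix (κ × ι' i) (κ × ι' i) ℂ),
        ∑ i, (K i)ᴴ * K i = 1 ∧
        (∀ i, IsLOCC k κ (ι' i) (S i)) ∧
        T = ∑ i, (K i ⊗ₖ (1 : Matrix κ κ ℂ))ᴴ * (S i).submatrix Prod.swap Prod.swap *
              (K i ⊗ₖ (1 : Matrix κ κ ℂ))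

section Classes

variable (ι κ : Type) [Fintype ι] [DecidableEq ι] [Fintype κ] [DecidableEq κ]

/-- Two-valued POVMs `{T, I - T}`, given by `T`, implemented with `k` rounds of communication. -/
def roundLOCC (k : ℕ) : Set (Matrix (ι × κ) (ι × κ) ℂ) :=
  {T | IsLOCC k ι κ T}

/-- One-way LOCC (from the first party to the second): one round of communication. -/
def oneWayLOCC : Set (Matrix (ι × κ) (ι × κ) ℂ) :=
  roundLOCC ι κ 1

/-- Two-way LOCC: the closure of the set of all LOCC POVMs with finitely many rounds. -/
def twoWayLOCC : Set (Matrix (ι × κ) (ι × κ) ℂ) :=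
  closure (⋃ k, roundLOCC ι κ k)

/-- Separable two-valued POVMs: both elements are separable. -/
def separablePOVM : Set (Matrix (ι × κ) (ι × κ) ℂ) :=
  {T | IsSeparable T ∧ IsSeparable (1 - T)}

end Classes

/-- The optimal type-2 error `Tr σ (I - T)` among the tests `T` of the class `C` whose type-1
error `Tr ρ T` is at most `α`. -/
def optimalError {ι : Type} [Fintype ι] [DecidableEq ι] (C : Set (Matrix ι ι ℂ)) (α : ℝ)
    (ρ σ : Matrix ι ι ℂ) : ℝ :=
  sInf {b | ∃ T ∈ C, (ρ * T).trace.re ≤ α ∧ b = (σ * (1 - T)).trace.re}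

/-- `-(1/n) log β_{n,C}(e^{-nr} | Ψ ‖ ρ_mix)`, where the class `C` is given as a function of the
two local systems. -/
def errorRate {dA dB : ℕ}
    (C : ∀ (ι κ : Type) [Fintype ι] [DecidableEq ι] [Fintype κ] [DecidableEq κ],
      Set (Matrix (ι × κ) (ι × κ) ℂ))
    (r : ℝ) (Ψ : EuclideanSpace ℂ (Fin dA × Fin dB)) (n : ℕ) : ℝ :=
  -(1 / (n : ℝ)) * Real.log (optimalError (C (Fin n → Fin dA) (Fin n → Fin dB))
    (Real.exp (-(n * r))) (copies n (pureState Ψ)) (copies n (mixedState dA dB)))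

/-- `sup_{0 ≤ s < 1} [-2 s r / (1 - s) - H_{(1+s)/2}(Ψ)] + log (d_A d_B)`. -/
def hoeffdingBound {dA dB : ℕ} (r : ℝ) (Ψ : EuclideanSpace ℂ (Fin dA × Fin dB)) : ℝ :=
  sSup ((fun s : ℝ => -(2 * s * r) / (1 - s) - renyiEntropy ((1 + s) / 2) Ψ) '' Set.Ico 0 1)
    + Real.log ((dA : ℝ) * dB)

end

end LocalTesting

/-! Since `ρ_mix` is proportional to the identity, the type-2 error on `n` copies is `Tr E / (d_A
d_B)^n` with `E = 1 - T`. The task is to find how fast the least trace of `E` must grow when `E`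
fails to detect `Ψ^{⊗n}` with probability at most `e^{-nr}`. Let `λ` be the nonzero squared Schmidt
coefficients, `Q_θ ∝ λ^θ`, `u(θ)` the mean of `-log λ` under `Q_θ`, `H(θ)` the entropy of `Q_θ`, and
`D(θ) = u(θ) - H(θ)` its divergence from `λ`. The optimal growth rate is `H(θ₁)` for one-way tests
and `H(θ₂) - D(θ₂)` for all the larger classes. Here `θ₁` and `θ₂` are critical parameters for `D =
r`, in `[0, 1)` and `[1/2, 1)` respectively (`IsCritical`).

Converse for separable tests (`sum_sqrt_le_of_isSeparable`): a separable `E` satisfies `⟨φ, Eφ⟩ ≤ Tr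
E` for the unnormalized flat vector `φ` on any set `S` of Schmidt indices. Splitting `⟨ψ, φ⟩` along
`1 = E + T` and using Cauchy–Schwarz gives `∑_S √λ ≤ √(Tr E) + √(type-1 error) √|S|`. This is a
closed condition on `T`, so it also covers the closure of LOCC. A set `S` of sequences typical for
`Q_θ`, with `θ` just above `θ₂`, gives the rate.

Achievability with two rounds (`exists_roundTwo_test_le`): Alice filters onto one of many sets `S`,
chosen so that the filter's effect on the trace is balanced. Bob measures in a Fourier basis of `S`,
and Alice tests for her conditional pure state. The trace is at most `(∑_Y √λ)^2 / ∑_Y λ` up to one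
plus the number of distinct weights, which is polynomial in `n`.

One-way tests reduce to classical tests of the Schmidt index (`exists_classical_test_of_oneWay`),
and comparing indices attains the classical bound (`exists_oneWay_test`). The supremum in the
theorem is evaluated at `θ₂` by convexity of `θ ↦ log ∑ λ^θ`. The gap between the rates is `H(θ₁) -
H(θ₂) + D(θ₂)`. As `θ₁ ≤ θ₂` and `H` decreases on `θ ≥ 0`, it is positive when `λ` is not constant,
since then `D(θ₂) > 0`. For constant `λ` it vanishes. -/

namespace LocalTesting

noncomputable section

set_option linter.unusedSectionVars false

/-! ### Exponential tilting and the single-letter optimization -/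

section Tilting

variable {X : Type*} [Fintype X]

/-- The power sum `∑ λ_x ^ θ`. -/
def powSum (lam : X → ℝ) (θ : ℝ) : ℝ := ∑ x, lam x ^ θ

/-- The mean surprisal `-∑ Q_x log λ_x` under the tilted distribution `Q ∝ λ ^ θ`. -/
def tiltedSurprisal (lam : X → ℝ) (θ : ℝ) : ℝ :=
  -(∑ x, lam x ^ θ * Real.log (lam x)) / powSum lam θ

/-- The Shannon entropy of the tilted distribution `Q ∝ λ ^ θ`. -/
def tiltedEntropy (lam : X → ℝ) (θ : ℝ) : ℝ :=
  θ * tiltedSurprisal lam θ + Real.log (powSum lam θ)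

/-- The relative entropy `D(Q ‖ λ)` of the tilted distribution `Q ∝ λ ^ θ`. -/
def tiltedDivergence (lam : X → ℝ) (θ : ℝ) : ℝ :=
  (1 - θ) * tiltedSurprisal lam θ - Real.log (powSum lam θ)

variable {lam : X → ℝ}

theorem powSum_pos [Nonempty X] (hlam : ∀ x, 0 < lam x) (θ : ℝ) : 0 < powSum lam θ :=
  Finset.sum_pos (fun x _ => Real.rpow_pos_of_pos (hlam x) θ) Finset.univ_nonempty

theorem continuous_powSum (hlam : ∀ x, 0 < lam x) : Continuous (powSum lam) :=
  continuous_finsetSum _ fun x _ => Real.continuous_const_rpow (hlam x).ne'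

theorem continuous_tiltedSurprisal [Nonempty X] (hlam : ∀ x, 0 < lam x) :
    Continuous (tiltedSurprisal lam) := by
  refine Continuous.div (Continuous.neg ?_) (continuous_powSum hlam)
    fun θ => (powSum_pos hlam θ).ne'
  exact continuous_finsetSum _ fun x _ =>
    (Real.continuous_const_rpow (hlam x).ne').mul continuous_const

theorem continuous_log_powSum [Nonempty X] (hlam : ∀ x, 0 < lam x) :
    Continuous fun θ => Real.log (powSum lam θ) :=
  (continuous_powSum hlam).log fun θ => (powSum_pos hlam θ).ne'

theorem continuous_tiltedEntropy [Nonempty X] (hlam : ∀ x, 0 < lam x) :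
    Continuous (tiltedEntropy lam) :=
  (continuous_id.mul (continuous_tiltedSurprisal hlam)).add (continuous_log_powSum hlam)

theorem continuous_tiltedDivergence [Nonempty X] (hlam : ∀ x, 0 < lam x) :
    Continuous (tiltedDivergence lam) :=
  ((continuous_const.sub continuous_id).mul (continuous_tiltedSurprisal hlam)).sub
    (continuous_log_powSum hlam)

/-- The linear term averages to zero under `Q_θ₀`, by the definition of mean surprisal. In this form
the tangent bound follows from `1 + z ≤ e^z` term by term. -/
theorem powSum_mul_exp_eq [Nonempty X] (hlam : ∀ x, 0 < lam x) (θ₀ θ : ℝ) :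
    powSum lam θ₀ * Real.exp (-((θ - θ₀) * tiltedSurprisal lam θ₀)) =
      ∑ x, lam x ^ θ₀ * (Real.exp (-((θ - θ₀) * tiltedSurprisal lam θ₀)) *
        ((θ - θ₀) * Real.log (lam x) + (θ - θ₀) * tiltedSurprisal lam θ₀ + 1)) := by
  have hZ := (powSum_pos hlam θ₀).ne'
  set e := Real.exp (-((θ - θ₀) * tiltedSurprisal lam θ₀))
  have h1 : ∑ x, lam x ^ θ₀ * Real.log (lam x) = -(tiltedSurprisal lam θ₀ * powSum lam θ₀) := by
    rw [tiltedSurprisal]; field_simp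
  have h2 : ∀ x, lam x ^ θ₀ * (e * ((θ - θ₀) * Real.log (lam x) +
      (θ - θ₀) * tiltedSurprisal lam θ₀ + 1)) = (e * (θ - θ₀)) * (lam x ^ θ₀ * Real.log (lam x)) +
      (e * ((θ - θ₀) * tiltedSurprisal lam θ₀ + 1)) * lam x ^ θ₀ := fun x => by ring
  simp_rw [h2]
  rw [Finset.sum_add_distrib, ← Finset.mul_sum, ← Finset.mul_sum, h1]
  change _ = _ + _ * powSum lam θ₀
  ring

theorem rpow_eq_tangent {X : Type*} {lam : X → ℝ} (hlam : ∀ x, 0 < lam x) (θ₀ θ v : ℝ) (x : X) :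
    lam x ^ θ = lam x ^ θ₀ * (Real.exp (-((θ - θ₀) * v)) *
      Real.exp ((θ - θ₀) * Real.log (lam x) + (θ - θ₀) * v)) := by
  rw [← Real.exp_add, Real.rpow_def_of_pos (hlam x), Real.rpow_def_of_pos (hlam x),
    ← Real.exp_add]
  congr 1; ring

/-- The tangent inequality for the convex function `θ ↦ log ∑ λ ^ θ`. -/
theorem log_powSum_ge_tangent [Nonempty X] (hlam : ∀ x, 0 < lam x) (θ₀ θ : ℝ) :
    Real.log (powSum lam θ₀) - (θ - θ₀) * tiltedSurprisal lam θ₀ ≤ Real.log (powSum lam θ) := by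
  have key : powSum lam θ₀ * Real.exp (-((θ - θ₀) * tiltedSurprisal lam θ₀)) ≤ powSum lam θ := by
    rw [powSum_mul_exp_eq hlam θ₀ θ, powSum]
    refine Finset.sum_le_sum fun x _ => ?_
    rw [rpow_eq_tangent hlam θ₀ θ (tiltedSurprisal lam θ₀) x]
    have := Real.rpow_pos_of_pos (hlam x) θ₀
    gcongr
    exact Real.add_one_le_exp _
  have := Real.log_le_log (mul_pos (powSum_pos hlam θ₀) (Real.exp_pos _)) key
  rw [Real.log_mul (powSum_pos hlam θ₀).ne' (Real.exp_pos _).ne', Real.log_exp] at this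
  linarith

/-- Equality in `1 + z ≤ e^z` holds only at `z = 0`; having it at every index would make `log λ`
constant. -/
theorem log_powSum_gt_tangent [Nonempty X] (hlam : ∀ x, 0 < lam x) {θ₀ θ : ℝ} (hθ : θ ≠ θ₀)
    (hflat : ∃ x y, lam x ≠ lam y) :
    Real.log (powSum lam θ₀) - (θ - θ₀) * tiltedSurprisal lam θ₀ < Real.log (powSum lam θ) := by
  have key : powSum lam θ₀ * Real.exp (-((θ - θ₀) * tiltedSurprisal lam θ₀)) < powSum lam θ := by
    rw [powSum_mul_exp_eq hlam θ₀ θ, powSum]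
    refine Finset.sum_lt_sum (fun x _ => ?_) ?_
    · rw [rpow_eq_tangent hlam θ₀ θ (tiltedSurprisal lam θ₀) x]
      have := Real.rpow_pos_of_pos (hlam x) θ₀
      gcongr
      exact Real.add_one_le_exp _
    · obtain ⟨x, hx⟩ : ∃ x, Real.log (lam x) ≠ -tiltedSurprisal lam θ₀ := by
        by_contra! h
        obtain ⟨x, y, hxy⟩ := hflat
        exact hxy (Real.log_injOn_pos (hlam x) (hlam y) ((h x).trans (h y).symm))
      refine ⟨x, Finset.mem_univ x, ?_⟩
      rw [rpow_eq_tangent hlam θ₀ θ (tiltedSurprisal lam θ₀) x]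
      have := Real.rpow_pos_of_pos (hlam x) θ₀
      gcongr
      refine Real.add_one_lt_exp ?_
      rw [← mul_add]
      exact mul_ne_zero (sub_ne_zero.2 hθ) fun h => hx (by linarith)
  have := Real.log_lt_log (mul_pos (powSum_pos hlam θ₀) (Real.exp_pos _)) key
  rw [Real.log_mul (powSum_pos hlam θ₀).ne' (Real.exp_pos _).ne', Real.log_exp] at this
  linarith

theorem log_powSum_one (hsum : ∑ x, lam x = 1) : Real.log (powSum lam 1) = 0 := by
  simp [powSum, hsum]

theorem tiltedDivergence_one (hsum : ∑ x, lam x = 1) : tiltedDivergence lam 1 = 0 := by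
  simp [tiltedDivergence, log_powSum_one hsum]

/-- This is the strict tangent inequality at `θ`, evaluated at `1`, where the log power sum
vanishes. -/
theorem tiltedDivergence_pos [Nonempty X] (hlam : ∀ x, 0 < lam x) (hsum : ∑ x, lam x = 1)
    (hflat : ∃ x y, lam x ≠ lam y) {θ : ℝ} (hθ : θ < 1) : 0 < tiltedDivergence lam θ := by
  have := log_powSum_gt_tangent hlam (θ₀ := θ) (θ := 1) hθ.ne' hflat
  rw [log_powSum_one hsum] at this
  rw [tiltedDivergence]; linarith

theorem tiltedSurprisal_antitone [Nonempty X] (hlam : ∀ x, 0 < lam x) :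
    Antitone (tiltedSurprisal lam) := by
  intro θ₁ θ₂ h
  rcases h.eq_or_lt with rfl | h
  · exact le_rfl
  have h1 := log_powSum_ge_tangent hlam θ₁ θ₂
  have h2 := log_powSum_ge_tangent hlam θ₂ θ₁
  have h3 : 0 ≤ (θ₂ - θ₁) * (tiltedSurprisal lam θ₁ - tiltedSurprisal lam θ₂) := by linarith
  have := nonneg_of_mul_nonneg_right h3 (by linarith)
  linarith

/-- The tangent at `θ₂`, evaluated at `θ₁`, gives `H(θ₂) ≤ log ∑ λ^θ₁ + θ₁ u(θ₂)`. Then `u(θ₂) ≤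
u(θ₁)` is multiplied by `θ₁ ≥ 0`. -/
theorem tiltedEntropy_antitoneOn [Nonempty X] (hlam : ∀ x, 0 < lam x) {θ₁ θ₂ : ℝ}
    (h0 : 0 ≤ θ₁) (h : θ₁ ≤ θ₂) : tiltedEntropy lam θ₂ ≤ tiltedEntropy lam θ₁ := by
  have h1 := log_powSum_ge_tangent hlam θ₂ θ₁
  have h2 := mul_le_mul_of_nonneg_left (tiltedSurprisal_antitone hlam h) h0
  rw [tiltedEntropy, tiltedEntropy]
  linarith

theorem tiltedEntropy_of_flat [Nonempty X] (hlam : ∀ x, 0 < lam x)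
    (hflat : ∀ x y, lam x = lam y) (θ : ℝ) :
    tiltedEntropy lam θ = Real.log (Fintype.card X) := by
  obtain ⟨z⟩ := ‹Nonempty X›
  have hc : (0 : ℝ) < Fintype.card X := by
    exact_mod_cast Fintype.card_pos_iff.2 ⟨z⟩
  have hz := Real.rpow_pos_of_pos (hlam z) θ
  have h1 : powSum lam θ = Fintype.card X * lam z ^ θ := by
    simp [powSum, fun x => hflat x z]
  have h2 : tiltedSurprisal lam θ = -Real.log (lam z) := by
    rw [tiltedSurprisal, h1]
    simp only [fun x => hflat x z, Finset.sum_const, Finset.card_univ, nsmul_eq_mul]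
    field_simp
  rw [tiltedEntropy, h1, h2, Real.log_mul hc.ne' hz.ne', Real.log_rpow (hlam z)]
  ring

theorem tiltedDivergence_of_flat [Nonempty X] (hlam : ∀ x, 0 < lam x) (hsum : ∑ x, lam x = 1)
    (hflat : ∀ x y, lam x = lam y) (θ : ℝ) : tiltedDivergence lam θ = 0 := by
  obtain ⟨z⟩ := ‹Nonempty X›
  have hc : (Fintype.card X : ℝ) * lam z = 1 := by
    rw [← hsum]; simp [fun x => hflat x z]
  have hc' : (0 : ℝ) < Fintype.card X := by
    exact_mod_cast Fintype.card_pos_iff.2 ⟨z⟩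
  have hz := Real.rpow_pos_of_pos (hlam z) θ
  have h1 : powSum lam θ = Fintype.card X * lam z ^ θ := by
    simp [powSum, fun x => hflat x z]
  have h2 : tiltedSurprisal lam θ = -Real.log (lam z) := by
    rw [tiltedSurprisal, h1]
    simp only [fun x => hflat x z, Finset.sum_const, Finset.card_univ, nsmul_eq_mul]
    field_simp
  have h3 : Real.log (Fintype.card X) = -Real.log (lam z) := by
    have := Real.log_mul hc'.ne' (hlam z).ne'
    rw [hc, Real.log_one] at this
    linarith
  rw [tiltedDivergence, h1, h2, Real.log_mul hc'.ne' hz.ne', Real.log_rpow (hlam z), h3]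
  ring

/-- The critical tilting parameter at divergence `r`, in the range `[a, 1)`. -/
def IsCritical (lam : X → ℝ) (a r θ : ℝ) : Prop :=
  a ≤ θ ∧ θ < 1 ∧ (tiltedDivergence lam θ = r ∨ θ = a ∧ tiltedDivergence lam θ ≤ r) ∧
    ∀ θ', θ < θ' → θ' < 1 → tiltedDivergence lam θ' < r

/-- The witness is the largest `θ` in `[a, 1]` with `D(θ) ≥ r`, or `a` if there is none. It lies
below `1` because `D(1) = 0 < r`. Only continuity of `D` is needed, not monotonicity. -/
theorem exists_isCritical [Nonempty X] (hlam : ∀ x, 0 < lam x) (hsum : ∑ x, lam x = 1)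
    {a r : ℝ} (ha : a < 1) (hr : 0 < r) : ∃ θ, IsCritical lam a r θ := by
  have hcont := continuous_tiltedDivergence hlam
  set s : Set ℝ := Set.Icc a 1 ∩ {θ | r ≤ tiltedDivergence lam θ} with hs
  have hcomp : IsCompact s := isCompact_Icc.inter_right (isClosed_le continuous_const hcont)
  by_cases hne : s.Nonempty
  · obtain ⟨θ, hθ, hmax⟩ := hcomp.exists_isMaxOn hne continuousOn_id
    have h1 : θ < 1 := by
      refine lt_of_le_of_ne hθ.1.2 ?_
      rintro rfl
      have := hθ.2
      rw [Set.mem_ofPred_eq, tiltedDivergence_one hsum] at this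
      linarith
    have hlt : ∀ θ', θ < θ' → θ' < 1 → tiltedDivergence lam θ' < r := by
      intro θ' h h'
      by_contra! hc
      have : θ' ≤ θ := hmax (a := θ') ⟨⟨hθ.1.1.trans h.le, h'.le⟩, hc⟩
      linarith
    refine ⟨θ, hθ.1.1, h1, Or.inl (le_antisymm ?_ hθ.2), hlt⟩
    have hne : (nhdsWithin θ (Set.Ioi θ)).NeBot := inferInstance
    refine le_of_tendsto (hcont.continuousAt.continuousWithinAt (s := Set.Ioi θ)).tendsto ?_
    filter_upwards [Ioo_mem_nhdsGT h1] with θ' h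
    exact (hlt θ' h.1 h.2).le
  · have hall : ∀ θ', a ≤ θ' → θ' < 1 → tiltedDivergence lam θ' < r := by
      intro θ' h h'
      by_contra! hc
      exact hne ⟨θ', ⟨h, h'.le⟩, hc⟩
    exact ⟨a, le_rfl, ha, Or.inr ⟨rfl, (hall a le_rfl ha).le⟩, fun θ' h h' => hall θ' h.le h'⟩

/-- The value of the Hoeffding bound: the supremum is attained at the critical parameter. -/
theorem isGreatest_hoeffding [Nonempty X] (hlam : ∀ x, 0 < lam x) {r θ₀ : ℝ}
    (h : IsCritical lam (1 / 2) r θ₀) :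
    IsGreatest ((fun s : ℝ => -(2 * s * r) / (1 - s) -
      Real.log (powSum lam ((1 + s) / 2)) / (1 - (1 + s) / 2)) '' Set.Ico 0 1)
      (tiltedDivergence lam θ₀ - tiltedEntropy lam θ₀) := by
  obtain ⟨ha, h1, hD, -⟩ := h
  constructor
  · refine ⟨2 * θ₀ - 1, ⟨by linarith, by linarith⟩, ?_⟩
    have e : (1 + (2 * θ₀ - 1)) / 2 = θ₀ := by ring
    have e' : 1 - (2 * θ₀ - 1) = 2 * (1 - θ₀) := by ring
    have hne : 1 - θ₀ ≠ 0 := by linarith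
    simp only [e, e']
    rcases hD with hD | ⟨rfl, -⟩
    · rw [hD, tiltedEntropy]
      rw [tiltedDivergence] at hD
      field_simp
      rw [← hD]
      ring
    · rw [tiltedDivergence, tiltedEntropy]; ring
  · rintro _ ⟨s, ⟨hs0, hs1⟩, rfl⟩
    set θ := (1 + s) / 2 with hθ
    have hsθ : s = 2 * θ - 1 := by rw [hθ]; ring
    have hθ1 : 0 < 1 - θ := by rw [hθ]; linarith
    have ht := log_powSum_ge_tangent hlam θ₀ θ
    simp only
    have e : -(2 * s * r) / (1 - s) = (-(2 * θ - 1) * r) / (1 - θ) := by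
      rw [hsθ]
      have : 1 - (2 * θ - 1) = 2 * (1 - θ) := by ring
      rw [this]; field_simp
    rw [e, ← sub_div, div_le_iff₀ hθ1]
    -- Besides the tangent inequality, the slack is `(2θ - 1)(r - D(θ₀))`. Its sign is where `s ≥
    -- 0`, that is `θ ≥ 1/2`, enters.
    have hkey : (2 * θ - 1) * tiltedDivergence lam θ₀ ≤ (2 * θ - 1) * r :=
      mul_le_mul_of_nonneg_left (by rcases hD with h | h <;> [exact h.le; exact h.2])
        (by linarith)
    have hid : (tiltedDivergence lam θ₀ - tiltedEntropy lam θ₀) * (1 - θ) =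
        -(2 * θ - 1) * tiltedDivergence lam θ₀ - (Real.log (powSum lam θ₀)
          - (θ - θ₀) * tiltedSurprisal lam θ₀) := by
      rw [tiltedEntropy, tiltedDivergence]; ring
    rw [hid]
    linarith

end Tilting

/-! ### Product weights: Chernoff bounds and counting -/

section Powers

variable {X : Type*} [Fintype X] {lam : X → ℝ}

/-- The weights of the `n`-fold product distribution. -/
def prodWeight {X : Type*} (lam : X → ℝ) (n : ℕ) (x : Fin n → X) : ℝ := ∏ k, lam (x k)

theorem prodWeight_pos {X : Type*} {lam : X → ℝ} (hlam : ∀ x, 0 < lam x) (n : ℕ) (x : Fin n → X) :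
    0 < prodWeight lam n x :=
  Finset.prod_pos fun k _ => hlam (x k)

theorem sum_prodWeight_rpow (hlam : ∀ x, 0 < lam x) (n : ℕ) (θ : ℝ) :
    ∑ x, prodWeight lam n x ^ θ = powSum lam θ ^ n := by
  classical
  rw [powSum, Fintype.sum_pow]
  refine Finset.sum_congr rfl fun x _ => ?_
  rw [prodWeight, Real.finsetProd_rpow _ _ fun k _ => (hlam _).le]

theorem sum_prodWeight_rpow_exp [Nonempty X] (hlam : ∀ x, 0 < lam x) (n : ℕ) (θ : ℝ) :
    ∑ x, prodWeight lam n x ^ θ = Real.exp (n * Real.log (powSum lam θ)) := by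
  rw [sum_prodWeight_rpow hlam, mul_comm, Real.exp_mul, Real.exp_log (powSum_pos hlam θ),
    Real.rpow_natCast]

/-- The sequences whose weight is at least `e^{-n v}`. -/
def heavy (lam : X → ℝ) (n : ℕ) (v : ℝ) : Finset (Fin n → X) :=
  {x | Real.exp (-(n * v)) ≤ prodWeight lam n x}

theorem mem_heavy {n : ℕ} {v : ℝ} {x : Fin n → X} :
    x ∈ heavy lam n v ↔ Real.exp (-(n * v)) ≤ prodWeight lam n x := by
  simp [heavy]

/-- Chernoff's argument: on light sequences the factor `weight^(θ - θ')` is at most `e^{-nv(θ -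
θ')}`, and the remaining power sum is extended to all sequences. `sum_heavy_rpow_le` is the mirror
image. -/
theorem sum_light_rpow_le [Nonempty X] [DecidableEq X] (hlam : ∀ x, 0 < lam x) (n : ℕ)
    (v : ℝ) {θ θ' : ℝ} (h : θ' ≤ θ) :
    ∑ x ∈ (heavy lam n v)ᶜ, prodWeight lam n x ^ θ ≤
      Real.exp (n * (Real.log (powSum lam θ') - (θ - θ') * v)) := by
  have hx : ∀ x ∈ (heavy lam n v)ᶜ, prodWeight lam n x ^ θ ≤
      Real.exp (-(n * v) * (θ - θ')) * prodWeight lam n x ^ θ' := by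
    intro x hx
    rw [Finset.mem_compl, mem_heavy, not_le] at hx
    have hp := prodWeight_pos hlam n x
    have : prodWeight lam n x ^ θ = prodWeight lam n x ^ (θ - θ') * prodWeight lam n x ^ θ' := by
      rw [← Real.rpow_add hp]; congr 1; ring
    rw [this, Real.exp_mul]
    gcongr
  calc _ ≤ ∑ x ∈ (heavy lam n v)ᶜ,
        Real.exp (-(n * v) * (θ - θ')) * prodWeight lam n x ^ θ' := Finset.sum_le_sum hx
    _ ≤ ∑ x, Real.exp (-(n * v) * (θ - θ')) * prodWeight lam n x ^ θ' :=
        Finset.sum_le_sum_of_subset_of_nonneg (Finset.subset_univ _) fun x _ _ =>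
          mul_nonneg (Real.exp_pos _).le (Real.rpow_nonneg (prodWeight_pos hlam n x).le _)
    _ = _ := by
        rw [← Finset.mul_sum, sum_prodWeight_rpow_exp hlam, ← Real.exp_add]
        congr 1; ring

theorem sum_heavy_rpow_le [Nonempty X] (hlam : ∀ x, 0 < lam x) (n : ℕ)
    (v : ℝ) {θ θ' : ℝ} (h : θ ≤ θ') :
    ∑ x ∈ heavy lam n v, prodWeight lam n x ^ θ ≤
      Real.exp (n * (Real.log (powSum lam θ') + (θ' - θ) * v)) := by
  have hx : ∀ x ∈ heavy lam n v, prodWeight lam n x ^ θ ≤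
      Real.exp (-(n * v) * (θ - θ')) * prodWeight lam n x ^ θ' := by
    intro x hx
    rw [mem_heavy] at hx
    have hp := prodWeight_pos hlam n x
    have : prodWeight lam n x ^ θ = prodWeight lam n x ^ (θ - θ') * prodWeight lam n x ^ θ' := by
      rw [← Real.rpow_add hp]; congr 1; ring
    rw [this, Real.exp_mul]
    gcongr ?_ * _
    exact Real.rpow_le_rpow_of_nonpos (Real.exp_pos _) hx (by linarith)
  calc _ ≤ ∑ x ∈ heavy lam n v,
        Real.exp (-(n * v) * (θ - θ')) * prodWeight lam n x ^ θ' := Finset.sum_le_sum hx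
    _ ≤ ∑ x, Real.exp (-(n * v) * (θ - θ')) * prodWeight lam n x ^ θ' :=
        Finset.sum_le_sum_of_subset_of_nonneg (Finset.subset_univ _) fun x _ _ =>
          mul_nonneg (Real.exp_pos _).le (Real.rpow_nonneg (prodWeight_pos hlam n x).le _)
    _ = _ := by
        rw [← Finset.mul_sum, sum_prodWeight_rpow_exp hlam, ← Real.exp_add]
        congr 1; ring

theorem eventually_exp_neg_le {c ε : ℝ} (hc : 0 < c) (hε : 0 < ε) :
    ∀ᶠ n : ℕ in Filter.atTop, Real.exp (-(n * c)) ≤ ε := by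
  have h : Filter.Tendsto (fun n : ℕ => Real.exp (-((n : ℝ) * c))) Filter.atTop (nhds 0) :=
    Real.tendsto_exp_neg_atTop_nhds_zero.comp
      (tendsto_natCast_atTop_atTop.atTop_mul_const hc)
  exact (h.eventually (ge_mem_nhds hε))

/-- The number of heavy sequences is at least `e^{n (H - δ)}` above the mean surprisal. -/
theorem eventually_card_heavy_ge [Nonempty X] (hlam : ∀ x, 0 < lam x) {θ δ : ℝ}
    (h0 : 0 ≤ θ) (h1 : θ ≤ 1) (hδ : 0 < δ) :
    ∀ᶠ n : ℕ in Filter.atTop, Real.exp (n * (tiltedEntropy lam θ - δ)) ≤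
      ((heavy lam n (tiltedSurprisal lam θ + δ)).card : ℝ) := by
  classical
  set u := tiltedSurprisal lam θ with hu
  have hcont := continuous_tiltedSurprisal hlam
  have e1 : ∀ᶠ t in nhdsWithin (0 : ℝ) (Set.Ioi 0), tiltedSurprisal lam (θ - t) < u + δ / 2 := by
    have : Filter.Tendsto (fun t => tiltedSurprisal lam (θ - t)) (nhds 0) (nhds u) := by
      have : Continuous fun t => tiltedSurprisal lam (θ - t) := by fun_prop
      simpa [hu] using this.tendsto 0
    exact (this.mono_left nhdsWithin_le_nhds).eventually (gt_mem_nhds (by linarith))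
  have e2 : ∀ᶠ t in nhdsWithin (0 : ℝ) (Set.Ioi 0), u - δ / 2 < tiltedSurprisal lam (θ + t) := by
    have : Filter.Tendsto (fun t => tiltedSurprisal lam (θ + t)) (nhds 0) (nhds u) := by
      have : Continuous fun t => tiltedSurprisal lam (θ + t) := by fun_prop
      simpa [hu] using this.tendsto 0
    exact (this.mono_left nhdsWithin_le_nhds).eventually (lt_mem_nhds (by linarith))
  -- Tilting by `±t` makes both tails of `Q_θ^n` outside surprisal rate `u ± δ/2` exponentially
  -- small. The exponents `c₁`, `c₂` are positive because `u` moves by less than `δ/2`.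
  obtain ⟨t, ⟨ht1, ht2⟩, ht⟩ := ((e1.and e2).and self_mem_nhdsWithin).exists
  set f := Real.log (powSum lam θ) with hf
  have t1 := log_powSum_ge_tangent hlam (θ - t) θ
  have t2 := log_powSum_ge_tangent hlam (θ + t) θ
  set c₁ := t * (u + δ / 2 - tiltedSurprisal lam (θ - t)) with hc₁
  set c₂ := t * (tiltedSurprisal lam (θ + t) - (u - δ / 2)) with hc₂
  have hc₁' : 0 < c₁ := mul_pos ht (by linarith)
  have hc₂' : 0 < c₂ := mul_pos ht (by linarith)
  filter_upwards [eventually_exp_neg_le hc₁' (show (0 : ℝ) < 1 / 4 by norm_num),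
    eventually_exp_neg_le hc₂' (show (0 : ℝ) < 1 / 4 by norm_num),
    eventually_exp_neg_le (half_pos hδ) (show (0 : ℝ) < 1 / 2 by norm_num)] with n n1 n2 n3
  have b1 := sum_light_rpow_le hlam n (u + δ / 2) (θ := θ) (θ' := θ - t) (by linarith)
  have b2 := sum_heavy_rpow_le hlam n (u - δ / 2) (θ := θ) (θ' := θ + t) (by linarith)
  have hn : (0 : ℝ) ≤ n := Nat.cast_nonneg n
  have b1' : ∑ x ∈ (heavy lam n (u + δ / 2))ᶜ, prodWeight lam n x ^ θ ≤ Real.exp (n * f) / 4 := by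
    refine b1.trans ?_
    have : (n : ℝ) * (Real.log (powSum lam (θ - t)) - (θ - (θ - t)) * (u + δ / 2)) ≤
        n * f + -(n * c₁) := by
      rw [hc₁, ← mul_neg, ← mul_add]
      refine mul_le_mul_of_nonneg_left ?_ hn
      linarith
    refine (Real.exp_le_exp.2 this).trans ?_
    rw [Real.exp_add]
    have := mul_le_mul_of_nonneg_left n1 (Real.exp_pos (n * f)).le
    linarith
  have b2' : ∑ x ∈ heavy lam n (u - δ / 2), prodWeight lam n x ^ θ ≤ Real.exp (n * f) / 4 := by
    refine b2.trans ?_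
    have : (n : ℝ) * (Real.log (powSum lam (θ + t)) + ((θ + t) - θ) * (u - δ / 2)) ≤
        n * f + -(n * c₂) := by
      rw [hc₂, ← mul_neg, ← mul_add]
      refine mul_le_mul_of_nonneg_left ?_ hn
      linarith
    refine (Real.exp_le_exp.2 this).trans ?_
    rw [Real.exp_add]
    have := mul_le_mul_of_nonneg_left n2 (Real.exp_pos (n * f)).le
    linarith
  have tot := sum_prodWeight_rpow_exp hlam n θ
  rw [← hf] at tot
  have split1 := Finset.sum_add_sum_compl (heavy lam n (u + δ / 2))
    fun x => prodWeight lam n x ^ θ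
  have hsub : heavy lam n (u - δ / 2) ⊆ heavy lam n (u + δ / 2) := by
    intro x hx
    rw [mem_heavy] at hx ⊢
    refine le_trans (Real.exp_le_exp.2 ?_) hx
    have : (n : ℝ) * (u - δ / 2) ≤ n * (u + δ / 2) :=
      mul_le_mul_of_nonneg_left (by linarith) hn
    linarith
  have split2 := Finset.sum_sdiff hsub (f := fun x => prodWeight lam n x ^ θ)
  -- Each tail carries at most a quarter of the total, so the typical shell keeps half. Dividing by
  -- the largest term in the shell bounds its cardinality.
  have low : Real.exp (n * f) / 2 ≤ ∑ x ∈ heavy lam n (u + δ / 2) \ heavy lam n (u - δ / 2),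
      prodWeight lam n x ^ θ := by linarith
  have up : ∑ x ∈ heavy lam n (u + δ / 2) \ heavy lam n (u - δ / 2), prodWeight lam n x ^ θ ≤
      ((heavy lam n (u + δ / 2)).card : ℝ) * Real.exp (-(n * (u - δ / 2)) * θ) := by
    calc _ ≤ ∑ x ∈ heavy lam n (u + δ / 2) \ heavy lam n (u - δ / 2),
          Real.exp (-(n * (u - δ / 2)) * θ) := by
          refine Finset.sum_le_sum fun x hx => ?_
          rw [Finset.mem_sdiff, mem_heavy, mem_heavy, not_le] at hx
          rw [Real.exp_mul]
          exact Real.rpow_le_rpow (prodWeight_pos hlam n x).le hx.2.le h0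
      _ ≤ _ := by
          rw [Finset.sum_const, nsmul_eq_mul]
          gcongr
          exact Finset.sdiff_subset
  have hcard : (heavy lam n (u + δ / 2)).card ≤ (heavy lam n (u + δ)).card := by
    refine Finset.card_le_card fun x hx => ?_
    rw [mem_heavy] at hx ⊢
    refine le_trans (Real.exp_le_exp.2 ?_) hx
    have : (n : ℝ) * (u + δ / 2) ≤ n * (u + δ) := mul_le_mul_of_nonneg_left (by linarith) hn
    linarith
  have hcard' : ((heavy lam n (u + δ / 2)).card : ℝ) ≤ (heavy lam n (u + δ)).card := by
    exact_mod_cast hcard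
  refine le_trans ?_ hcard'
  have comb := low.trans up
  have hE := Real.exp_pos (-(n * (u - δ / 2)) * θ)
  have h4 : Real.exp (n * (tiltedEntropy lam θ - δ)) * Real.exp (-(n * (u - δ / 2)) * θ) ≤
      Real.exp (n * f) / 2 := by
    rw [← Real.exp_add]
    have : n * (tiltedEntropy lam θ - δ) + -(n * (u - δ / 2)) * θ ≤ n * f + -(n * (δ / 2)) := by
      rw [tiltedEntropy, ← hu, ← hf]
      have : (n : ℝ) * (θ * (δ / 2)) ≤ n * (1 * (δ / 2)) := by gcongr
      linarith
    refine (Real.exp_le_exp.2 this).trans ?_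
    rw [Real.exp_add]
    have := mul_le_mul_of_nonneg_left n3 (Real.exp_pos (n * f)).le
    linarith
  exact le_of_mul_le_mul_right (h4.trans comb) hE

/-- The product weights take only polynomially many values. -/
theorem card_image_prodWeight_le [DecidableEq X] (n : ℕ) (s : Finset (Fin n → X)) :
    (s.image (prodWeight lam n)).card ≤ (n + 1) ^ Fintype.card X := by
  -- The weight of a sequence depends only on its type, the letter counts between `0` and `n`.
  have hsub : s.image (prodWeight lam n) ⊆
      (Finset.univ : Finset (X → Fin (n + 1))).image fun c => ∏ i, lam i ^ (c i : ℕ) := by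
    intro v hv
    obtain ⟨x, -, rfl⟩ := Finset.mem_image.1 hv
    refine Finset.mem_image.2 ⟨fun i => ⟨(Finset.univ.filter fun k => x k = i).card, ?_⟩,
      Finset.mem_univ _, ?_⟩
    · exact Nat.lt_succ_of_le ((Finset.card_le_univ _).trans (by simp))
    · rw [prodWeight, ← Finset.prod_fiberwise Finset.univ x]
      refine Finset.prod_congr rfl fun i _ => ?_
      rw [Finset.prod_congr rfl (g := fun _ => lam i), Finset.prod_const]
      intro k hk
      rw [(Finset.mem_filter.1 hk).2]
  refine (Finset.card_le_card hsub).trans (Finset.card_image_le.trans ?_)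
  simp

end Powers

/-! ### Inequalities for positive semidefinite matrices -/

section PosSemidef

variable {ι κ X : Type*} [Fintype ι] [Fintype κ] [Fintype X]

/-- The expectation value `⟨ψ, T ψ⟩`. -/
def expect (ψ : ι → ℂ) (T : Matrix ι ι ℂ) : ℝ := (star ψ ⬝ᵥ T *ᵥ ψ).re

theorem trace_pure_mul (ψ : ι → ℂ) (T : Matrix ι ι ℂ) :
    (Matrix.vecMulVec ψ (star ψ) * T).trace.re = expect ψ T := by
  rw [Matrix.vecMulVec_mul, Matrix.trace_vecMulVec, expect, Matrix.dotProduct_mulVec,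
    dotProduct_comm]

theorem expect_nonneg {T : Matrix ι ι ℂ} (hT : T.PosSemidef) (ψ : ι → ℂ) : 0 ≤ expect ψ T :=
  (Complex.nonneg_iff.1 (hT.dotProduct_mulVec_nonneg ψ)).1

theorem expect_sub (ψ : ι → ℂ) (S T : Matrix ι ι ℂ) :
    expect ψ (S - T) = expect ψ S - expect ψ T := by
  simp [expect, Matrix.sub_mulVec, dotProduct_sub]

theorem expect_sum {α : Type*} (s : Finset α) (ψ : ι → ℂ) (T : α → Matrix ι ι ℂ) :
    expect ψ (∑ i ∈ s, T i) = ∑ i ∈ s, expect ψ (T i) := by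
  simp [expect, Matrix.sum_mulVec, dotProduct_sum]

theorem continuous_expect (ψ : ι → ℂ) : Continuous (expect ψ) := by
  unfold expect
  fun_prop

theorem exists_eq_conjTranspose_mul_self {A : Matrix ι ι ℂ} (hA : A.PosSemidef) :
    ∃ B : Matrix ι ι ℂ, A = Bᴴ * B := by
  classical
  open scoped MatrixOrder in
  exact CStarAlgebra.nonneg_iff_eq_star_mul_self.1 hA.nonneg

theorem norm_star_dotProduct_sq_le (v w : ι → ℂ) :
    ‖star v ⬝ᵥ w‖ ^ 2 ≤ (star v ⬝ᵥ v).re * (star w ⬝ᵥ w).re := by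
  have h := norm_inner_le_norm (𝕜 := ℂ) (WithLp.toLp 2 v) (WithLp.toLp 2 w)
  have hn : ∀ u : ι → ℂ, (star u ⬝ᵥ u).re = ‖WithLp.toLp 2 u‖ ^ 2 := by
    intro u
    rw [EuclideanSpace.norm_sq_eq, dotProduct, Complex.re_sum]
    refine Finset.sum_congr rfl fun i _ => ?_
    simp [Complex.sq_norm, Complex.normSq_apply]
  rw [hn, hn, ← mul_pow]
  have e : inner ℂ (WithLp.toLp 2 v) (WithLp.toLp 2 w) = star v ⬝ᵥ w := by
    rw [EuclideanSpace.inner_eq_star_dotProduct, dotProduct_comm]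
  rw [e] at h
  gcongr

theorem norm_dotProduct_mulVec_sq_le {T : Matrix ι ι ℂ} (hT : T.PosSemidef) (ψ φ : ι → ℂ) :
    ‖star ψ ⬝ᵥ T *ᵥ φ‖ ^ 2 ≤ expect ψ T * expect φ T := by
  obtain ⟨B, rfl⟩ := exists_eq_conjTranspose_mul_self hT
  have h : ∀ a b : ι → ℂ, star a ⬝ᵥ (Bᴴ * B) *ᵥ b = star (B *ᵥ a) ⬝ᵥ (B *ᵥ b) := by
    intro a b
    rw [Matrix.star_mulVec, ← Matrix.dotProduct_mulVec, Matrix.mulVec_mulVec]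
  rw [expect, expect, h, h, h]
  exact norm_star_dotProduct_sq_le _ _

theorem norm_apply_sq_le {A : Matrix X X ℂ} (hA : A.PosSemidef) (x y : X) :
    ‖A x y‖ ^ 2 ≤ (A x x).re * (A y y).re := by
  classical
  have h := norm_dotProduct_mulVec_sq_le hA (Pi.single x 1) (Pi.single y 1)
  simpa [expect, ← Pi.single_star] using h

theorem trace_re_nonneg {A : Matrix X X ℂ} (hA : A.PosSemidef) : 0 ≤ A.trace.re :=
  (Complex.nonneg_iff.1 hA.trace_nonneg).1

theorem diag_re_nonneg {A : Matrix X X ℂ} (hA : A.PosSemidef) (x : X) : 0 ≤ (A x x).re :=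
  (Complex.nonneg_iff.1 hA.diag_nonneg).1

theorem trace_im_eq_zero {A : Matrix X X ℂ} (hA : A.PosSemidef) : A.trace.im = 0 :=
  (Complex.nonneg_iff.1 hA.trace_nonneg).2.symm

/-- Off-diagonal entries are dominated by diagonal ones, `|A x y| ≤ √(A x x) √(A y y)`, so the
double sum is at most `(∑ √(A x x) √(B x x))^2`. Cauchy–Schwarz finishes. -/
theorem re_sum_sum_mul_le_trace_mul_trace {A B : Matrix X X ℂ} (hA : A.PosSemidef)
    (hB : B.PosSemidef) {c : X → ℝ} (h0 : ∀ x, 0 ≤ c x) (h1 : ∀ x, c x ≤ 1) :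
    (∑ x, ∑ y, (c x : ℂ) * c y * (A x y * B x y)).re ≤ A.trace.re * B.trace.re := by
  set w : X → ℝ := fun x => √((A x x).re) * √((B x x).re) with hw
  have hw0 : ∀ x, 0 ≤ w x := fun x => by positivity
  have hterm : ∀ x y, ‖(c x : ℂ) * c y * (A x y * B x y)‖ ≤ w x * w y := by
    intro x y
    have hA' : ‖A x y‖ ≤ √((A x x).re) * √((A y y).re) := by
      rw [← Real.sqrt_mul (diag_re_nonneg hA x)]
      exact Real.le_sqrt_of_sq_le (norm_apply_sq_le hA x y)
    have hB' : ‖B x y‖ ≤ √((B x x).re) * √((B y y).re) := by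
      rw [← Real.sqrt_mul (diag_re_nonneg hB x)]
      exact Real.le_sqrt_of_sq_le (norm_apply_sq_le hB x y)
    have hc : c x * c y ≤ 1 := mul_le_one₀ (h1 x) (h0 y) (h1 y)
    have hc0 : 0 ≤ c x * c y := mul_nonneg (h0 x) (h0 y)
    calc ‖(c x : ℂ) * c y * (A x y * B x y)‖ = c x * c y * (‖A x y‖ * ‖B x y‖) := by
          simp [abs_of_nonneg (h0 x), abs_of_nonneg (h0 y)]
      _ ≤ 1 * ((√((A x x).re) * √((A y y).re)) * (√((B x x).re) * √((B y y).re))) := by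
          gcongr
      _ = w x * w y := by rw [hw]; ring
  calc (∑ x, ∑ y, (c x : ℂ) * c y * (A x y * B x y)).re
      ≤ ‖∑ x, ∑ y, (c x : ℂ) * c y * (A x y * B x y)‖ := Complex.re_le_norm _
    _ ≤ ∑ x, ∑ y, w x * w y := by
        refine (norm_sum_le _ _).trans (Finset.sum_le_sum fun x _ => ?_)
        exact (norm_sum_le _ _).trans (Finset.sum_le_sum fun y _ => hterm x y)
    _ = (∑ x, w x) ^ 2 := by rw [sq, Finset.sum_mul_sum]
    _ ≤ (∑ x, √((A x x).re) ^ 2) * ∑ x, √((B x x).re) ^ 2 := Finset.sum_mul_sq_le_sq_mul_sq _ _ _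
    _ = A.trace.re * B.trace.re := by
        simp only [Matrix.trace, Matrix.diag, Complex.re_sum]
        congr 1 <;> refine Finset.sum_congr rfl fun x _ => Real.sq_sqrt ?_
        exacts [diag_re_nonneg hA x, diag_re_nonneg hB x]

variable [DecidableEq ι] [DecidableEq X] [DecidableEq κ]

theorem posSemidef_one_sub_isometry {V : Matrix ι X ℂ} (hV : Vᴴ * V = 1) :
    (1 - V * Vᴴ).PosSemidef := by
  have h : (1 - V * Vᴴ) = (1 - V * Vᴴ)ᴴ * (1 - V * Vᴴ) := by
    have h2 : V * Vᴴ * (V * Vᴴ) = V * Vᴴ := by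
      rw [Matrix.mul_assoc, ← Matrix.mul_assoc Vᴴ, hV, Matrix.one_mul]
    simp only [Matrix.conjTranspose_sub, Matrix.conjTranspose_one, Matrix.conjTranspose_mul,
      Matrix.conjTranspose_conjTranspose, Matrix.sub_mul, Matrix.mul_sub, Matrix.one_mul,
      Matrix.mul_one, h2]
    abel
  rw [h]
  exact Matrix.posSemidef_conjTranspose_mul_self _

/-- By cyclicity this is the positivity of `A` against the projection `1 - V Vᴴ`. -/
theorem trace_isometry_le {V : Matrix ι X ℂ} (hV : Vᴴ * V = 1) {A : Matrix ι ι ℂ}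
    (hA : A.PosSemidef) : (Vᴴ * A * V).trace.re ≤ A.trace.re := by
  obtain ⟨B, rfl⟩ := exists_eq_conjTranspose_mul_self hA
  have h := trace_re_nonneg ((posSemidef_one_sub_isometry hV).mul_mul_conjTranspose_same B)
  rw [Matrix.mul_sub, Matrix.sub_mul, Matrix.mul_one, Matrix.trace_sub, Complex.sub_re,
    Matrix.trace_mul_comm B Bᴴ] at h
  have e : (Vᴴ * (Bᴴ * B) * V).trace = (B * (V * Vᴴ) * Bᴴ).trace := by
    rw [Matrix.trace_mul_cycle, Matrix.trace_mul_cycle B, Matrix.trace_mul_comm]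
  rw [e]
  linarith

/-- With `N = Bᴴ B`, Cauchy–Schwarz is applied to each row of `B`; the squared row norms add up to
the trace. -/
theorem posSemidef_trace_smul_one_sub {N : Matrix κ κ ℂ} (hN : N.PosSemidef) :
    (((N.trace.re : ℝ) : ℂ) • (1 : Matrix κ κ ℂ) - N).PosSemidef := by
  refine Matrix.PosSemidef.of_dotProduct_mulVec_nonneg ?_ fun v => ?_
  · refine Matrix.IsHermitian.sub ?_ hN.isHermitian
    rw [Matrix.IsHermitian, Matrix.conjTranspose_smul, Matrix.conjTranspose_one]
    simp
  · have key : expect v N ≤ N.trace.re * (star v ⬝ᵥ v).re := by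
      obtain ⟨B, rfl⟩ := exists_eq_conjTranspose_mul_self hN
      have h1 : expect v (Bᴴ * B) = ∑ i, ‖(B *ᵥ v) i‖ ^ 2 := by
        rw [expect, ← Matrix.mulVec_mulVec, Matrix.dotProduct_mulVec, ← Matrix.star_mulVec,
          dotProduct, Complex.re_sum]
        refine Finset.sum_congr rfl fun i _ => ?_
        simp [Complex.sq_norm, Complex.normSq_apply]
      have h2 : (Bᴴ * B).trace.re = ∑ i, (B i ⬝ᵥ star (B i)).re := by
        rw [Matrix.trace_mul_comm, Matrix.trace, Complex.re_sum]
        exact Finset.sum_congr rfl fun i _ => by simp [Matrix.mul_apply, dotProduct]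
      rw [h1, h2, Finset.sum_mul]
      refine Finset.sum_le_sum fun i _ => ?_
      have := norm_star_dotProduct_sq_le (star (B i)) v
      rw [star_star] at this
      exact this
    have him : (star v ⬝ᵥ N *ᵥ v).im = 0 :=
      (Complex.nonneg_iff.1 (hN.dotProduct_mulVec_nonneg v)).2.symm
    have him' : (star v ⬝ᵥ v).im = 0 :=
      (Complex.nonneg_iff.1 (dotProduct_star_self_nonneg v)).2.symm
    rw [Matrix.sub_mulVec, Matrix.smul_mulVec, Matrix.one_mulVec, dotProduct_sub,
      dotProduct_smul, Complex.nonneg_iff]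
    constructor
    · rw [expect] at key
      simp
      linarith
    · simp [him, him']

end PosSemidef

/-! ### Vectors in Schmidt form -/

section SchmidtVec

variable {ι κ X : Type*} [Fintype ι] [Fintype κ] [Fintype X]

/-- The vector `∑ c_x V_x ⊗ W_x`, where `V_x` and `W_x` are the columns of `V` and `W`. -/
def schmidtVec (V : Matrix ι X ℂ) (W : Matrix κ X ℂ) (c : X → ℝ) : ι × κ → ℂ :=
  fun p => ∑ x, (c x : ℂ) * (V p.1 x * W p.2 x)

theorem schmidtVec_eq_mulVec [DecidableEq X] (V : Matrix ι X ℂ) (W : Matrix κ X ℂ) (c : X → ℝ) :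
    schmidtVec V W c =
      (V ⊗ₖ W) *ᵥ fun p : X × X => if p.1 = p.2 then (c p.1 : ℂ) else 0 := by
  ext p
  simp only [schmidtVec, Matrix.mulVec, dotProduct, Fintype.sum_prod_type, mul_ite, mul_zero,
    Finset.sum_ite_eq, Finset.mem_univ, if_true]
  exact Finset.sum_congr rfl fun x _ => mul_comm _ _

/-- A Schmidt vector is the image under `V ⊗ W` of a vector supported on the diagonal of `X × X`.
Only the entrywise product of the two compressed operators therefore survives. -/
theorem dotProduct_kronecker_mulVec [DecidableEq X] (V : Matrix ι X ℂ) (W : Matrix κ X ℂ)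
    (c c' : X → ℝ) (A : Matrix ι ι ℂ) (B : Matrix κ κ ℂ) :
    star (schmidtVec V W c) ⬝ᵥ (A ⊗ₖ B) *ᵥ schmidtVec V W c' =
      ∑ x, ∑ y, (c x : ℂ) * c' y * ((Vᴴ * A * V) x y * (Wᴴ * B * W) x y) := by
  rw [schmidtVec_eq_mulVec, schmidtVec_eq_mulVec, Matrix.star_mulVec, ← Matrix.dotProduct_mulVec,
    Matrix.mulVec_mulVec, Matrix.mulVec_mulVec, Matrix.conjTranspose_kronecker,
    ← Matrix.mul_kronecker_mul, ← Matrix.mul_kronecker_mul]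
  simp only [Matrix.mulVec, dotProduct, Fintype.sum_prod_type,
    Matrix.kronecker_apply, mul_ite, mul_zero, Finset.sum_ite_eq, Finset.mem_univ, if_true,
    Pi.star_apply, apply_ite star, star_zero, ite_mul, zero_mul]
  refine Finset.sum_congr rfl fun x _ => ?_
  rw [Finset.mul_sum]
  refine Finset.sum_congr rfl fun y _ => ?_
  simp only [Complex.star_def, Complex.conj_ofReal]
  ring

variable [DecidableEq ι] [DecidableEq κ] [DecidableEq X]

theorem dotProduct_schmidtVec {V : Matrix ι X ℂ} {W : Matrix κ X ℂ} (hV : Vᴴ * V = 1)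
    (hW : Wᴴ * W = 1) (c c' : X → ℝ) :
    star (schmidtVec V W c) ⬝ᵥ schmidtVec V W c' = ((∑ x, c x * c' x : ℝ) : ℂ) := by
  have h := dotProduct_kronecker_mulVec V W c c' 1 1
  rw [Matrix.one_kronecker_one, Matrix.one_mulVec, Matrix.mul_one, Matrix.mul_one, hV, hW] at h
  rw [h]
  simp [Matrix.one_apply]

theorem expect_kronecker_one {V : Matrix ι X ℂ} {W : Matrix κ X ℂ} (hW : Wᴴ * W = 1)
    (c : X → ℝ) (A : Matrix ι ι ℂ) :
    expect (schmidtVec V W c) (A ⊗ₖ (1 : Matrix κ κ ℂ)) =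
      ∑ x, c x ^ 2 * ((Vᴴ * A * V) x x).re := by
  rw [expect, dotProduct_kronecker_mulVec, Matrix.mul_one, hW]
  simp only [Matrix.one_apply, mul_ite, mul_one, mul_zero, Finset.sum_ite_eq, Finset.mem_univ,
    if_true, Complex.re_sum]
  refine Finset.sum_congr rfl fun x _ => ?_
  rw [← Complex.ofReal_mul, Complex.re_ofReal_mul, sq]

theorem expect_one {V : Matrix ι X ℂ} {W : Matrix κ X ℂ} (hV : Vᴴ * V = 1)
    (hW : Wᴴ * W = 1) (c : X → ℝ) : expect (schmidtVec V W c) 1 = ∑ x, c x ^ 2 := by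
  rw [expect, Matrix.one_mulVec, dotProduct_schmidtVec hV hW, Complex.ofReal_re]
  exact Finset.sum_congr rfl fun x _ => (sq _).symm

end SchmidtVec

/-! ### Separable operators contain finite-round LOCC -/

section Separable

variable {ι κ : Type}

theorem kronecker_submatrix_swap (A : Matrix ι ι ℂ) (B : Matrix κ κ ℂ) :
    (A ⊗ₖ B).submatrix Prod.swap Prod.swap = B ⊗ₖ A := by
  ext ⟨a, b⟩ ⟨a', b'⟩
  simp [mul_comm]

theorem sum_kronecker {α : Type*} (s : Finset α) {l m n p : Type*} (A : α → Matrix l m ℂ)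
    (B : Matrix n p ℂ) : (∑ i ∈ s, A i) ⊗ₖ B = ∑ i ∈ s, A i ⊗ₖ B := by
  ext ⟨a, b⟩ ⟨a', b'⟩
  simp [Matrix.sum_apply, Finset.sum_mul]

theorem sub_kronecker {l m n p : Type*} (A A' : Matrix l m ℂ) (B : Matrix n p ℂ) :
    (A - A') ⊗ₖ B = A ⊗ₖ B - A' ⊗ₖ B := by
  ext ⟨a, b⟩ ⟨a', b'⟩
  simp [sub_mul]

theorem kronecker_sub {l m n p : Type*} (A : Matrix l m ℂ) (B B' : Matrix n p ℂ) :
    A ⊗ₖ (B - B') = A ⊗ₖ B - A ⊗ₖ B' := by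
  ext ⟨a, b⟩ ⟨a', b'⟩
  simp [mul_sub]

theorem isSeparable_sum_fintype {α : Type*} [Fintype α] {A : α → Matrix ι ι ℂ}
    {B : α → Matrix κ κ ℂ} (hA : ∀ i, (A i).PosSemidef) (hB : ∀ i, (B i).PosSemidef) :
    IsSeparable (∑ i, A i ⊗ₖ B i) := by
  refine ⟨Fintype.card α, fun i => A ((Fintype.equivFin α).symm i),
    fun i => B ((Fintype.equivFin α).symm i), fun i => hA _, fun i => hB _, ?_⟩
  exact (Equiv.sum_comp (Fintype.equivFin α).symm fun i => A i ⊗ₖ B i).symm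

theorem isSeparable_kronecker {A : Matrix ι ι ℂ} {B : Matrix κ κ ℂ} (hA : A.PosSemidef)
    (hB : B.PosSemidef) : IsSeparable (A ⊗ₖ B) :=
  ⟨1, fun _ => A, fun _ => B, fun _ => hA, fun _ => hB, by simp⟩

theorem IsSeparable.sum {m : ℕ} {T : Fin m → Matrix (ι × κ) (ι × κ) ℂ}
    (h : ∀ i, IsSeparable (T i)) : IsSeparable (∑ i, T i) := by
  choose k A B hA hB hT using h
  have := isSeparable_sum_fintype (α := Σ i, Fin (k i)) (A := fun p => A p.1 p.2)
    (B := fun p => B p.1 p.2) (fun p => hA _ _) (fun p => hB _ _)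
  rw [Fintype.sum_sigma] at this
  simpa only [← hT] using this

theorem IsSeparable.swap {T : Matrix (κ × ι) (κ × ι) ℂ} (h : IsSeparable T) :
    IsSeparable (T.submatrix Prod.swap Prod.swap) := by
  obtain ⟨m, A, B, hA, hB, rfl⟩ := h
  refine ⟨m, B, A, hB, hA, ?_⟩
  ext ⟨a, b⟩ ⟨a', b'⟩
  simp [Matrix.sum_apply, mul_comm]

theorem IsSeparable.posSemidef [Fintype ι] [Fintype κ] {T : Matrix (ι × κ) (ι × κ) ℂ}
    (h : IsSeparable T) : T.PosSemidef := by
  obtain ⟨m, A, B, hA, hB, rfl⟩ := h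
  exact Matrix.posSemidef_sum _ fun i _ => (hA i).kronecker (hB i)

theorem IsSeparable.conj_kronecker_one {ι' : Type} [Fintype ι'] [Fintype κ] [DecidableEq κ]
    [Fintype ι] {T : Matrix (ι' × κ) (ι' × κ) ℂ} (h : IsSeparable T) (K : Matrix ι' ι ℂ) :
    IsSeparable ((K ⊗ₖ (1 : Matrix κ κ ℂ))ᴴ * T * (K ⊗ₖ (1 : Matrix κ κ ℂ))) := by
  obtain ⟨m, A, B, hA, hB, rfl⟩ := h
  refine ⟨m, fun i => Kᴴ * A i * K, B, fun i => (hA i).conjTranspose_mul_mul_same K, hB, ?_⟩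
  rw [Matrix.mul_sum, Matrix.sum_mul]
  refine Finset.sum_congr rfl fun i _ => ?_
  rw [Matrix.conjTranspose_kronecker, ← Matrix.mul_kronecker_mul, ← Matrix.mul_kronecker_mul]
  simp

/-- Both elements of a finite-round LOCC measurement are separable. -/
theorem IsLOCC.isSeparable (k : ℕ) : ∀ (ι κ : Type) [Fintype ι] [DecidableEq ι] [Fintype κ]
    [DecidableEq κ] (T : Matrix (ι × κ) (ι × κ) ℂ), IsLOCC k ι κ T →
    IsSeparable T ∧ IsSeparable (1 - T) := by
  induction k with
  | zero =>
    rintro ι κ _ _ _ _ T ⟨M, h0, h1, rfl⟩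
    refine ⟨isSeparable_kronecker h0 .one, ?_⟩
    rw [← Matrix.one_kronecker_one, ← sub_kronecker]
    exact isSeparable_kronecker h1 .one
  | succ k ih =>
    rintro ι κ _ _ _ _ T ⟨m, ι', _, _, K, S, hK, hS, rfl⟩
    constructor
    · exact IsSeparable.sum fun i => (ih _ _ _ (hS i)).1.swap.conj_kronecker_one (K i)
    -- Writing `1` with the same Kraus operators exhibits `1 - T` as the same protocol with each `S
    -- i` replaced by `1 - S i`.
    · have h1 : (1 : Matrix (ι × κ) (ι × κ) ℂ) = ∑ i, (K i ⊗ₖ (1 : Matrix κ κ ℂ))ᴴ *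
          (1 : Matrix (κ × ι' i) (κ × ι' i) ℂ).submatrix Prod.swap Prod.swap *
          (K i ⊗ₖ (1 : Matrix κ κ ℂ)) := by
        rw [← Matrix.one_kronecker_one, ← hK, sum_kronecker]
        refine Finset.sum_congr rfl fun i _ => ?_
        rw [← Matrix.one_kronecker_one, kronecker_submatrix_swap, Matrix.one_kronecker_one,
          Matrix.mul_one, Matrix.conjTranspose_kronecker, ← Matrix.mul_kronecker_mul]
        simp
      rw [h1, ← Finset.sum_sub_distrib]
      refine IsSeparable.sum fun i => ?_
      rw [← Matrix.sub_mul, ← Matrix.mul_sub]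
      have := (ih _ _ _ (hS i)).2.swap.conj_kronecker_one (K i)
      rwa [Matrix.submatrix_sub] at this

end Separable

/-! ### Converse for separable and two-way LOCC tests -/

section SeparableConverse

variable {ι κ X : Type} [Fintype ι] [Fintype κ] [Fintype X] [DecidableEq ι] [DecidableEq κ]
  [DecidableEq X] {V : Matrix ι X ℂ} {W : Matrix κ X ℂ}

theorem expect_schmidtVec_le_trace (hV : Vᴴ * V = 1) (hW : Wᴴ * W = 1)
    {E : Matrix (ι × κ) (ι × κ) ℂ} (hE : IsSeparable E) {c : X → ℝ} (h0 : ∀ x, 0 ≤ c x)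
    (h1 : ∀ x, c x ≤ 1) : expect (schmidtVec V W c) E ≤ E.trace.re := by
  obtain ⟨m, A, B, hA, hB, rfl⟩ := hE
  rw [expect_sum, Matrix.trace_sum, Complex.re_sum]
  refine Finset.sum_le_sum fun i _ => ?_
  rw [expect, dotProduct_kronecker_mulVec, Matrix.trace_kronecker]
  have hA' := (hA i).conjTranspose_mul_mul_same V
  have hB' := (hB i).conjTranspose_mul_mul_same W
  refine (re_sum_sum_mul_le_trace_mul_trace hA' hB' h0 h1).trans ?_
  rw [Complex.mul_re, trace_im_eq_zero (hA i), zero_mul, sub_zero]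
  exact mul_le_mul (trace_isometry_le hV (hA i)) (trace_isometry_le hW (hB i))
    (trace_re_nonneg hB') (trace_re_nonneg (hA i))

/-- The one-shot converse for separable measurements. -/
theorem sum_sqrt_le_of_isSeparable (hV : Vᴴ * V = 1) (hW : Wᴴ * W = 1) {lam : X → ℝ}
    (hlam : ∀ x, 0 < lam x) (hsum : ∑ x, lam x = 1) {T : Matrix (ι × κ) (ι × κ) ℂ}
    (hT : IsSeparable T) (hE : IsSeparable (1 - T)) (S : Finset X) :
    ∑ x ∈ S, √(lam x) ≤ √((1 - T).trace.re) +
      √(expect (schmidtVec V W fun x => √(lam x)) T) * √(S.card : ℝ) := by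
  set ψ := schmidtVec V W fun x => √(lam x) with hψ
  set c : X → ℝ := fun x => if x ∈ S then 1 else 0 with hc
  have h0 : ∀ x, 0 ≤ c x := fun x => by rw [hc]; positivity
  have h1 : ∀ x, c x ≤ 1 := fun x => by
    simp only [hc]; split_ifs <;> norm_num
  set φ := schmidtVec V W c with hφ
  have hTr := expect_schmidtVec_le_trace hV hW hE h0 h1
  have hψ1 : expect ψ 1 = 1 := by
    rw [hψ, expect_one hV hW]
    simp_rw [Real.sq_sqrt (hlam _).le]
    exact hsum
  have hφ1 : expect φ 1 = S.card := by
    rw [hφ, expect_one hV hW]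
    simp [hc]
  have hψφ : star ψ ⬝ᵥ φ = ((∑ x ∈ S, √(lam x) : ℝ) : ℂ) := by
    rw [hψ, hφ, dotProduct_schmidtVec hV hW]
    simp [hc]
  -- Each part is a positive form, so Cauchy–Schwarz applies. The first uses `⟨ψ, (1 - T)ψ⟩ ≤ 1` and
  -- the trace bound on `φ`; the second uses `⟨φ, Tφ⟩ ≤ |S|`.
  have hsplit : star ψ ⬝ᵥ φ = star ψ ⬝ᵥ (1 - T) *ᵥ φ + star ψ ⬝ᵥ T *ᵥ φ := by
    rw [← dotProduct_add, ← Matrix.add_mulVec, sub_add_cancel, Matrix.one_mulVec]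
  have c1 := norm_dotProduct_mulVec_sq_le hE.posSemidef ψ φ
  have c2 := norm_dotProduct_mulVec_sq_le hT.posSemidef ψ φ
  have pE := expect_nonneg hE.posSemidef
  have pT := expect_nonneg hT.posSemidef
  have sE := expect_sub ψ 1 T
  have sE' := expect_sub φ 1 T
  have b1 : ‖star ψ ⬝ᵥ (1 - T) *ᵥ φ‖ ≤ √((1 - T).trace.re) := by
    refine Real.le_sqrt_of_sq_le (c1.trans ?_)
    have : expect ψ (1 - T) ≤ 1 := by linarith [pT ψ]
    calc _ ≤ 1 * expect φ (1 - T) := mul_le_mul_of_nonneg_right this (pE φ)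
      _ ≤ _ := by rw [one_mul]; exact hTr
  have b2 : ‖star ψ ⬝ᵥ T *ᵥ φ‖ ≤ √(expect ψ T) * √(S.card : ℝ) := by
    rw [← Real.sqrt_mul (pT ψ)]
    refine Real.le_sqrt_of_sq_le (c2.trans ?_)
    exact mul_le_mul_of_nonneg_left (by linarith [pE φ]) (pT ψ)
  calc ∑ x ∈ S, √(lam x) = ‖star ψ ⬝ᵥ φ‖ := by
        rw [hψφ, Complex.norm_real, Real.norm_of_nonneg]
        exact Finset.sum_nonneg fun x _ => Real.sqrt_nonneg _
    _ ≤ _ := by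
        rw [hsplit]
        exact (norm_add_le _ _).trans (add_le_add b1 b2)

/-- Both sides are continuous in `T`, so the inequality itself passes to the closure; closedness of
separability is not needed. -/
theorem sum_sqrt_le_of_mem_twoWayLOCC (hV : Vᴴ * V = 1) (hW : Wᴴ * W = 1) {lam : X → ℝ}
    (hlam : ∀ x, 0 < lam x) (hsum : ∑ x, lam x = 1) {T : Matrix (ι × κ) (ι × κ) ℂ}
    (hT : T ∈ twoWayLOCC ι κ) (S : Finset X) :
    ∑ x ∈ S, √(lam x) ≤ √((1 - T).trace.re) +
      √(expect (schmidtVec V W fun x => √(lam x)) T) * √(S.card : ℝ) := by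
  have hclosed : IsClosed {T : Matrix (ι × κ) (ι × κ) ℂ | ∑ x ∈ S, √(lam x) ≤
      √((1 - T).trace.re) +
        √(expect (schmidtVec V W fun x => √(lam x)) T) * √(S.card : ℝ)} := by
    refine isClosed_le continuous_const ?_
    have := continuous_expect (schmidtVec V W fun x => √(lam x))
    have h2 : Continuous fun T : Matrix (ι × κ) (ι × κ) ℂ => (1 - T).trace :=
      (continuous_const.sub continuous_id).matrix_trace
    fun_prop
  refine closure_minimal ?_ hclosed hT
  refine Set.iUnion_subset fun k T hT => ?_
  obtain ⟨h1, h2⟩ := IsLOCC.isSeparable k ι κ T hT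
  exact sum_sqrt_le_of_isSeparable hV hW hlam hsum h1 h2 S

end SeparableConverse

/-! ### Converse for one-way LOCC tests -/

section OneWay

variable {ι κ X : Type} [Fintype ι] [Fintype κ] [Fintype X] [DecidableEq ι] [DecidableEq κ]
  [DecidableEq X] {V : Matrix ι X ℂ} {W : Matrix κ X ℂ}

theorem one_sub_eq_of_isLOCC_one {T : Matrix (ι × κ) (ι × κ) ℂ} (hT : T ∈ oneWayLOCC ι κ) :
    ∃ (m : ℕ) (A : Fin m → Matrix ι ι ℂ) (N : Fin m → Matrix κ κ ℂ),
      (∀ i, (A i).PosSemidef) ∧ ∑ i, A i = 1 ∧ (∀ i, (N i).PosSemidef) ∧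
      (∀ i, (1 - N i).PosSemidef) ∧ 1 - T = ∑ i, A i ⊗ₖ N i := by
  obtain ⟨m, ι', _, _, K, S, hK, hS, rfl⟩ := hT
  choose M h0 h1 hM using hS
  refine ⟨m, fun i => (K i)ᴴ * K i, fun i => 1 - M i,
    fun i => Matrix.posSemidef_conjTranspose_mul_self _, hK, h1, fun i => ?_, ?_⟩
  · rw [sub_sub_cancel]; exact h0 i
  · rw [← Matrix.one_kronecker_one, ← hK, sum_kronecker, ← Finset.sum_sub_distrib]
    refine Finset.sum_congr rfl fun i _ => ?_
    rw [hM, kronecker_submatrix_swap, Matrix.conjTranspose_kronecker, ← Matrix.mul_kronecker_mul,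
      ← Matrix.mul_kronecker_mul, kronecker_sub]
    simp

/-- A one-way measurement is no better than a classical test of the Schmidt index. -/
theorem exists_classical_test_of_oneWay (hV : Vᴴ * V = 1) (hW : Wᴴ * W = 1) {lam : X → ℝ}
    (hlam : ∀ x, 0 < lam x) (hsum : ∑ x, lam x = 1) {T : Matrix (ι × κ) (ι × κ) ℂ}
    (hT : T ∈ oneWayLOCC ι κ) :
    ∃ t : X → ℝ, (∀ x, 0 ≤ t x) ∧ (∀ x, t x ≤ 1) ∧ ∑ x, t x ≤ (1 - T).trace.re ∧
      ∑ x, lam x * (1 - t x) ≤ expect (schmidtVec V W fun x => √(lam x)) T := by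
  obtain ⟨m, A, N, hA, hA1, hN, hN1, hT⟩ := one_sub_eq_of_isLOCC_one hT
  -- The choice `τ = min(1, Tr N_i)` dominates `N_i` in operator order without exceeding its trace.
  have hτ : ∀ i, ∃ τ : ℝ, 0 ≤ τ ∧ τ ≤ 1 ∧ τ ≤ (N i).trace.re ∧
      ((τ : ℂ) • (1 : Matrix κ κ ℂ) - N i).PosSemidef := by
    intro i
    rcases le_total 1 (N i).trace.re with h | h
    · exact ⟨1, zero_le_one, le_rfl, h, by simpa using hN1 i⟩
    · exact ⟨_, trace_re_nonneg (hN i), h, le_rfl, posSemidef_trace_smul_one_sub (hN i)⟩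
  choose τ hτ0 hτ1 hτN hτP using hτ
  have hAV : ∀ i, (Vᴴ * A i * V).PosSemidef := fun i => (hA i).conjTranspose_mul_mul_same V
  have hAVsum : ∀ x, ∑ i, ((Vᴴ * A i * V) x x).re = 1 := by
    intro x
    rw [← Complex.re_sum, ← Matrix.sum_apply, ← Matrix.sum_mul, ← Matrix.mul_sum, hA1,
      Matrix.mul_one, hV]
    simp
  -- Once `N_i` is replaced by the scalar `τ_i`, Bob's system is traced out, and only the
  -- distribution of Alice's outcome given Schmidt index `x` matters.
  refine ⟨fun x => ∑ i, τ i * ((Vᴴ * A i * V) x x).re, fun x => ?_, fun x => ?_, ?_, ?_⟩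
  · exact Finset.sum_nonneg fun i _ => mul_nonneg (hτ0 i) (diag_re_nonneg (hAV i) x)
  · rw [← hAVsum x]
    exact Finset.sum_le_sum fun i _ => mul_le_of_le_one_left (diag_re_nonneg (hAV i) x) (hτ1 i)
  · rw [Finset.sum_comm, hT, Matrix.trace_sum, Complex.re_sum]
    refine Finset.sum_le_sum fun i _ => ?_
    rw [← Finset.mul_sum, Matrix.trace_kronecker, Complex.mul_re, trace_im_eq_zero (hA i),
      zero_mul, sub_zero, mul_comm]
    have h := trace_isometry_le hV (hA i)
    rw [Matrix.trace, Complex.re_sum] at h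
    exact mul_le_mul h (hτN i) (hτ0 i) (trace_re_nonneg (hA i))
  · set ψ := schmidtVec V W fun x => √(lam x) with hψ
    have h1 : expect ψ 1 = 1 := by
      rw [hψ, expect_one hV hW]
      simp_rw [Real.sq_sqrt (hlam _).le]
      exact hsum
    have h2 := expect_sub ψ 1 T
    have h3 : expect ψ (1 - T) ≤ ∑ x, lam x * ∑ i, τ i * ((Vᴴ * A i * V) x x).re := by
      have e : ∑ x, lam x * ∑ i, τ i * ((Vᴴ * A i * V) x x).re =
          ∑ i, expect ψ (A i ⊗ₖ ((τ i : ℂ) • (1 : Matrix κ κ ℂ))) := by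
        simp_rw [Finset.mul_sum]
        rw [Finset.sum_comm]
        refine Finset.sum_congr rfl fun i _ => ?_
        rw [Matrix.kronecker_smul, ← Matrix.smul_kronecker, hψ, expect_kronecker_one hW]
        refine Finset.sum_congr rfl fun x _ => ?_
        rw [Real.sq_sqrt (hlam x).le]
        simp
      rw [e, hT, expect_sum]
      refine Finset.sum_le_sum fun i _ => ?_
      have := expect_nonneg ((hA i).kronecker (hτP i)) ψ
      rw [kronecker_sub, expect_sub] at this
      linarith
    simp_rw [mul_sub, mul_one]
    rw [Finset.sum_sub_distrib, hsum]
    linarith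

end OneWay

/-! ### Building LOCC protocols from incomplete measurements -/

section Protocols

variable {ι κ : Type} [Fintype ι] [Fintype κ] [DecidableEq ι] [DecidableEq κ]

/-- The missing part of Alice's measurement becomes an extra outcome `none`, on which Bob always
answers `T`. -/
theorem one_sub_sum_mem_oneWayLOCC {α : Type*} [Fintype α] {A : α → Matrix ι ι ℂ}
    {N : α → Matrix κ κ ℂ} (hA : ∀ i, (A i).PosSemidef) (hA1 : (1 - ∑ i, A i).PosSemidef)
    (hN : ∀ i, (N i).PosSemidef) (hN1 : ∀ i, (1 - N i).PosSemidef) :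
    1 - ∑ i, A i ⊗ₖ N i ∈ oneWayLOCC ι κ := by
  choose K hK using fun i => exists_eq_conjTranspose_mul_self (hA i)
  obtain ⟨K₀, hK₀⟩ := exists_eq_conjTranspose_mul_self hA1
  let e := (Fintype.equivFin (Option α)).symm
  let K' : Option α → Matrix ι ι ℂ := fun i => i.elim K₀ K
  let N' : Option α → Matrix κ κ ℂ := fun i => i.elim 0 N
  have hsum : ∑ i, (K' i)ᴴ * K' i = 1 := by
    rw [Fintype.sum_option]
    simp only [K', Option.elim_none, Option.elim_some, ← hK, ← hK₀, sub_add_cancel]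
  refine ⟨Fintype.card (Option α), fun _ => ι, fun _ => inferInstance, fun _ => inferInstance,
    fun i => K' (e i), fun i => (1 - N' (e i)) ⊗ₖ (1 : Matrix ι ι ℂ), ?_, fun i => ?_, ?_⟩
  · rw [Equiv.sum_comp e fun i => (K' i)ᴴ * K' i]
    exact hsum
  · refine ⟨1 - N' (e i), ?_, ?_, rfl⟩
    · cases e i with
      | none => simpa [N'] using Matrix.PosSemidef.one
      | some i => exact hN1 i
    · rw [sub_sub_cancel]
      cases e i with
      | none => exact Matrix.PosSemidef.zero
      | some i => exact hN i
  · have hterm : ∀ i, (K' i ⊗ₖ (1 : Matrix κ κ ℂ))ᴴ *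
        ((1 - N' i) ⊗ₖ (1 : Matrix ι ι ℂ)).submatrix Prod.swap Prod.swap *
        (K' i ⊗ₖ (1 : Matrix κ κ ℂ)) =
        ((K' i)ᴴ * K' i) ⊗ₖ (1 : Matrix κ κ ℂ) - ((K' i)ᴴ * K' i) ⊗ₖ N' i := by
      intro i
      rw [kronecker_submatrix_swap, Matrix.conjTranspose_kronecker, ← Matrix.mul_kronecker_mul,
        ← Matrix.mul_kronecker_mul, ← kronecker_sub]
      simp
    rw [Equiv.sum_comp e fun i => (K' i ⊗ₖ (1 : Matrix κ κ ℂ))ᴴ *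
        ((1 - N' i) ⊗ₖ (1 : Matrix ι ι ℂ)).submatrix Prod.swap Prod.swap *
        (K' i ⊗ₖ (1 : Matrix κ κ ℂ))]
    simp_rw [hterm]
    rw [Finset.sum_sub_distrib, ← sum_kronecker, hsum, Matrix.one_kronecker_one,
      Fintype.sum_option]
    simp [K', N', ← hK]

/-- After Alice's filter the rest is a one-way protocol from Bob to Alice. As before, the completing
outcome always answers `T`. -/
theorem one_sub_sum_mem_roundLOCC_two {α : Type*} [Fintype α] {β : α → Type*}
    [∀ i, Fintype (β i)] {K : α → Matrix ι ι ℂ} {B : ∀ i, β i → Matrix κ κ ℂ}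
    {M : ∀ i, β i → Matrix ι ι ℂ} (hK : (1 - ∑ i, (K i)ᴴ * K i).PosSemidef)
    (hB : ∀ i l, (B i l).PosSemidef) (hB1 : ∀ i, (1 - ∑ l, B i l).PosSemidef)
    (hM : ∀ i l, (M i l).PosSemidef) (hM1 : ∀ i l, (1 - M i l).PosSemidef) :
    1 - ∑ i, ∑ l, ((K i)ᴴ * M i l * K i) ⊗ₖ B i l ∈ roundLOCC ι κ 2 := by
  obtain ⟨K₀, hK₀⟩ := exists_eq_conjTranspose_mul_self hK
  let e := (Fintype.equivFin (Option α)).symm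
  let K' : Option α → Matrix ι ι ℂ := fun i => i.elim K₀ K
  let E' : Option α → Matrix (κ × ι) (κ × ι) ℂ :=
    fun i => i.elim 0 fun i => ∑ l, B i l ⊗ₖ M i l
  have hsum : ∑ i, (K' i)ᴴ * K' i = 1 := by
    rw [Fintype.sum_option]
    simp only [K', Option.elim_none, Option.elim_some, ← hK₀, sub_add_cancel]
  refine ⟨Fintype.card (Option α), fun _ => ι, fun _ => inferInstance, fun _ => inferInstance,
    fun i => K' (e i), fun i => 1 - E' (e i), ?_, fun i => ?_, ?_⟩
  · rw [Equiv.sum_comp e fun i => (K' i)ᴴ * K' i]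
    exact hsum
  · change IsLOCC 1 κ ι (1 - E' (e i))
    generalize e i = j
    cases j with
    | none =>
      have := one_sub_sum_mem_oneWayLOCC (ι := κ) (κ := ι) (α := Empty) (A := fun _ => 0)
        (N := fun _ => 0) (fun i => i.elim) (by simpa using Matrix.PosSemidef.one)
        (fun i => i.elim) (fun i => i.elim)
      simpa [E'] using show IsLOCC 1 κ ι _ from this
    | some i => exact one_sub_sum_mem_oneWayLOCC (hB i) (hB1 i) (hM i) (hM1 i)
  · have hterm : ∀ i, (K' i ⊗ₖ (1 : Matrix κ κ ℂ))ᴴ *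
        (1 - E' i).submatrix Prod.swap Prod.swap * (K' i ⊗ₖ (1 : Matrix κ κ ℂ)) =
        ((K' i)ᴴ * K' i) ⊗ₖ (1 : Matrix κ κ ℂ) - (K' i ⊗ₖ (1 : Matrix κ κ ℂ))ᴴ *
        (E' i).submatrix Prod.swap Prod.swap * (K' i ⊗ₖ (1 : Matrix κ κ ℂ)) := by
      intro i
      rw [← Matrix.one_kronecker_one, Matrix.submatrix_sub, Pi.sub_apply, Pi.sub_apply,
        kronecker_submatrix_swap,
        Matrix.mul_sub, Matrix.sub_mul, Matrix.one_kronecker_one, Matrix.mul_one,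
        Matrix.conjTranspose_kronecker, ← Matrix.mul_kronecker_mul]
      simp
    rw [Equiv.sum_comp e fun i => (K' i ⊗ₖ (1 : Matrix κ κ ℂ))ᴴ *
        (1 - E' i).submatrix Prod.swap Prod.swap * (K' i ⊗ₖ (1 : Matrix κ κ ℂ))]
    simp_rw [hterm]
    rw [Finset.sum_sub_distrib, ← sum_kronecker, hsum, Matrix.one_kronecker_one,
      Fintype.sum_option]
    congr 1
    have h0 : (E' none).submatrix Prod.swap Prod.swap = (0 : Matrix (ι × κ) (ι × κ) ℂ) := rfl
    rw [h0, Matrix.mul_zero, Matrix.zero_mul, zero_add]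
    refine Finset.sum_congr rfl fun i _ => ?_
    have h1 : (E' (some i)).submatrix Prod.swap Prod.swap = ∑ l, M i l ⊗ₖ B i l := by
      ext ⟨a, b⟩ ⟨a', b'⟩
      simp [E', Matrix.sum_apply, mul_comm]
    rw [h1, Matrix.mul_sum, Matrix.sum_mul]
    refine Finset.sum_congr rfl fun l _ => ?_
    rw [Matrix.conjTranspose_kronecker, ← Matrix.mul_kronecker_mul, ← Matrix.mul_kronecker_mul]
    simp [K']

end Protocols

/-! ### Rank-one effects and diagonal filters -/

section RankOne

variable {ι κ X : Type*} [Fintype ι] [Fintype κ] [Fintype X] [DecidableEq ι] [DecidableEq κ]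
  [DecidableEq X] {V : Matrix ι X ℂ} {W : Matrix κ X ℂ}

/-- The operator `|V a⟩⟨V a|`. -/
def rankOne (V : Matrix ι X ℂ) (a : X → ℂ) : Matrix ι ι ℂ :=
  V * Matrix.vecMulVec a (star a) * Vᴴ

theorem posSemidef_rankOne (V : Matrix ι X ℂ) (a : X → ℂ) : (rankOne V a).PosSemidef :=
  (Matrix.posSemidef_vecMulVec_self_star a).mul_mul_conjTranspose_same V

theorem conj_isometry_conj (hV : Vᴴ * V = 1) (G : Matrix X X ℂ) :
    Vᴴ * (V * G * Vᴴ) * V = G := by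
  calc Vᴴ * (V * G * Vᴴ) * V = (Vᴴ * V) * G * (Vᴴ * V) := by simp only [Matrix.mul_assoc]
    _ = G := by rw [hV, Matrix.one_mul, Matrix.mul_one]

theorem trace_conj_isometry (hV : Vᴴ * V = 1) (G : Matrix X X ℂ) :
    (V * G * Vᴴ).trace = G.trace := by
  rw [Matrix.trace_mul_cycle, hV, Matrix.one_mul]

theorem posSemidef_one_sub_conj (hV : Vᴴ * V = 1) {G : Matrix X X ℂ}
    (hG : (1 - G).PosSemidef) : (1 - V * G * Vᴴ).PosSemidef := by
  have := (posSemidef_one_sub_isometry hV).add (hG.mul_mul_conjTranspose_same V)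
  rwa [Matrix.mul_sub, Matrix.sub_mul, Matrix.mul_one, sub_add_sub_cancel] at this

theorem sum_rankOne {α : Type*} (s : Finset α) (V : Matrix ι X ℂ) (a : α → X → ℂ) :
    ∑ l ∈ s, rankOne V (a l) =
      V * (∑ l ∈ s, Matrix.vecMulVec (a l) (star (a l))) * Vᴴ := by
  simp only [rankOne, Matrix.mul_sum, Matrix.sum_mul]

theorem trace_rankOne (hV : Vᴴ * V = 1) (a : X → ℂ) :
    (rankOne V a).trace = ((∑ x, ‖a x‖ ^ 2 : ℝ) : ℂ) := by
  rw [rankOne, trace_conj_isometry hV, Matrix.trace_vecMulVec, dotProduct]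
  push_cast
  exact Finset.sum_congr rfl fun x _ => Complex.mul_conj' (a x)

theorem posSemidef_one_sub_rankOne (hV : Vᴴ * V = 1) {a : X → ℂ} (ha : ∑ x, ‖a x‖ ^ 2 = 1) :
    (1 - rankOne V a).PosSemidef := by
  have := posSemidef_trace_smul_one_sub (posSemidef_rankOne V a)
  rw [trace_rankOne hV, ha] at this
  simpa using this

theorem expect_rankOne_kronecker (hV : Vᴴ * V = 1) (hW : Wᴴ * W = 1) (c : X → ℝ)
    (a b : X → ℂ) : expect (schmidtVec V W c) (rankOne V a ⊗ₖ rankOne W b) =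
      ‖∑ x, c x * (a x * b x)‖ ^ 2 := by
  rw [expect, dotProduct_kronecker_mulVec, rankOne, rankOne, conj_isometry_conj hV,
    conj_isometry_conj hW]
  have h : ∑ x, ∑ y, (c x : ℂ) * c y * (Matrix.vecMulVec a (star a) x y *
      Matrix.vecMulVec b (star b) x y) =
      (∑ x, c x * (a x * b x)) * star (∑ x, (c x : ℂ) * (a x * b x)) := by
    rw [star_sum, Finset.sum_mul_sum]
    refine Finset.sum_congr rfl fun x _ => Finset.sum_congr rfl fun y _ => ?_
    simp only [Matrix.vecMulVec_apply, Pi.star_apply, star_mul', Complex.star_def,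
      Complex.conj_ofReal]
    ring
  rw [h, Complex.star_def, Complex.mul_conj', ← Complex.ofReal_pow, Complex.ofReal_re]

theorem conj_diagonal_rankOne (hV : Vᴴ * V = 1) (w : X → ℝ) (a : X → ℂ) :
    (V * Matrix.diagonal (fun x => (w x : ℂ)) * Vᴴ)ᴴ * rankOne V a *
      (V * Matrix.diagonal (fun x => (w x : ℂ)) * Vᴴ) = rankOne V fun x => w x * a x := by
  have hd : (Matrix.diagonal fun x => (w x : ℂ))ᴴ = Matrix.diagonal fun x => (w x : ℂ) := by
    rw [Matrix.diagonal_conjTranspose]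
    congr 1
    ext x
    simp
  rw [Matrix.conjTranspose_mul, Matrix.conjTranspose_mul, Matrix.conjTranspose_conjTranspose, hd]
  have h1 : ∀ D G : Matrix X X ℂ, V * (D * Vᴴ) * (V * G * Vᴴ) * (V * D * Vᴴ) =
      V * (D * (Vᴴ * V) * G * (Vᴴ * V) * D) * Vᴴ := by
    intro D G
    simp only [Matrix.mul_assoc]
  rw [rankOne, h1, hV, rankOne]
  congr 2
  ext x y
  simp [Matrix.diagonal_mul, Matrix.mul_diagonal, Matrix.vecMulVec_apply]
  ring

theorem conj_diagonal_sq (hV : Vᴴ * V = 1) (w : X → ℝ) :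
    (V * Matrix.diagonal (fun x => (w x : ℂ)) * Vᴴ)ᴴ *
      (V * Matrix.diagonal (fun x => (w x : ℂ)) * Vᴴ) =
      V * Matrix.diagonal (fun x => ((w x ^ 2 : ℝ) : ℂ)) * Vᴴ := by
  have hd : (Matrix.diagonal fun x => (w x : ℂ))ᴴ = Matrix.diagonal fun x => (w x : ℂ) := by
    rw [Matrix.diagonal_conjTranspose]
    congr 1
    ext x
    simp
  rw [Matrix.conjTranspose_mul, Matrix.conjTranspose_mul, Matrix.conjTranspose_conjTranspose, hd]
  have h1 : ∀ D : Matrix X X ℂ, V * (D * Vᴴ) * (V * D * Vᴴ) = V * (D * (Vᴴ * V) * D) * Vᴴ := by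
    intro D
    simp only [Matrix.mul_assoc]
  rw [h1, hV, Matrix.mul_one, Matrix.diagonal_mul_diagonal]
  simp [sq]

theorem posSemidef_one_sub_diagonal {d : X → ℝ} (h : ∀ x, d x ≤ 1) :
    (1 - Matrix.diagonal fun x => (d x : ℂ)).PosSemidef := by
  rw [← Matrix.diagonal_one, Matrix.diagonal_sub]
  refine Matrix.PosSemidef.diagonal fun x => ?_
  have : (0 : ℝ) ≤ 1 - d x := sub_nonneg.2 (h x)
  simp only [Pi.zero_apply]
  exact_mod_cast this

end RankOne

/-! ### Fourier bases -/

section Fourier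

/-- A Fourier basis supported on a finite set. -/
theorem exists_fourier_basis {X : Type*} [DecidableEq X] {S : Finset X} (hS : S.Nonempty) :
    ∃ b : Fin S.card → X → ℂ, (∀ l, ∀ x ∈ S, ‖b l x‖ ^ 2 = (S.card : ℝ)⁻¹) ∧
      (∀ l, ∀ x ∉ S, b l x = 0) ∧
      ∀ x y, ∑ l, b l x * star (b l y) = if x = y ∧ x ∈ S then 1 else 0 := by
  have hm : S.card ≠ 0 := (Finset.card_pos.2 hS).ne'
  have : NeZero S.card := ⟨hm⟩
  have hm' : (0 : ℝ) < S.card := by exact_mod_cast Finset.card_pos.2 hS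
  let e : S ≃ ZMod S.card := Fintype.equivOfCardEq (by simp [ZMod.card])
  let g : Fin S.card ≃ ZMod S.card := Fintype.equivOfCardEq (by simp [ZMod.card])
  let χ : AddChar (ZMod S.card) ℂ := ZMod.stdAddChar
  let b : Fin S.card → X → ℂ := fun l x =>
    if h : x ∈ S then ((√(S.card : ℝ))⁻¹ : ℝ) * χ (g l * e ⟨x, h⟩) else 0
  refine ⟨b, fun l x hx => ?_, fun l x hx => dif_neg hx, fun x y => ?_⟩
  · simp only [b, dif_pos hx, norm_mul, AddChar.norm_apply, mul_one, Complex.norm_real,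
      norm_inv, Real.norm_eq_abs, inv_pow, sq_abs, Real.sq_sqrt hm'.le]
  · by_cases hx : x ∈ S
    · by_cases hy : y ∈ S
      · have hterm : ∀ l, b l x * star (b l y) =
            ((S.card : ℝ)⁻¹ : ℝ) * χ (g l * (e ⟨x, hx⟩ - e ⟨y, hy⟩)) := by
          intro l
          simp only [b, dif_pos hx, dif_pos hy, star_mul', Complex.star_def, Complex.conj_ofReal]
          rw [← AddChar.map_neg_eq_conj, mul_sub, sub_eq_add_neg, AddChar.map_add_eq_mul]
          have : (((√(S.card : ℝ))⁻¹ : ℝ) : ℂ) * ((√(S.card : ℝ))⁻¹ : ℝ) =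
              ((S.card : ℝ)⁻¹ : ℝ) := by
            rw [← Complex.ofReal_mul, ← mul_inv, Real.mul_self_sqrt hm'.le]
          rw [← this]
          ring
        simp_rw [hterm]
        -- Orthogonality of the characters of `ZMod S.card`, with `S` identified with it by an
        -- arbitrary bijection.
        rw [← Finset.mul_sum,
          Equiv.sum_comp g fun l => χ (l * (e ⟨x, hx⟩ - e ⟨y, hy⟩)),
          AddChar.sum_mulShift _ (ZMod.isPrimitive_stdAddChar _)]
        by_cases hxy : x = y
        · subst hxy
          simp [hx, ZMod.card, hm]
        · have : e ⟨x, hx⟩ - e ⟨y, hy⟩ ≠ 0 := by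
            rw [sub_ne_zero]
            intro h
            exact hxy (by simpa using e.injective h)
          simp [this, hxy]
      · have : x ≠ y := fun h => hy (h ▸ hx)
        simp [b, hy, this]
    · simp [b, hx]

end Fourier

/-! ### One-way and two-round tests -/

section Tests

variable {ι κ X : Type} [Fintype ι] [Fintype κ] [Fintype X] [DecidableEq ι] [DecidableEq κ]
  [DecidableEq X] {V : Matrix ι X ℂ} {W : Matrix κ X ℂ}

/-- Both parties measure the Schmidt index and compare. -/
theorem exists_oneWay_test (hV : Vᴴ * V = 1) (hW : Wᴴ * W = 1) {lam : X → ℝ}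
    (hlam : ∀ x, 0 < lam x) (S : Finset X) :
    ∃ T ∈ oneWayLOCC ι κ, (1 - T).trace.re = S.card ∧
      expect (schmidtVec V W fun x => √(lam x)) (1 - T) = ∑ x ∈ S, lam x := by
  set δ : X → X → ℂ := fun x => Pi.single x 1 with hδ
  have hunit : ∀ x, ∑ y, ‖δ x y‖ ^ 2 = 1 := by
    intro x
    rw [Finset.sum_eq_single x]
    · simp [hδ]
    · intro y _ hy
      simp [hδ, hy]
    · simp
  have hsum : ∑ x : S, rankOne V (δ x) =
      V * Matrix.diagonal (fun x => ((if x ∈ S then 1 else 0 : ℝ) : ℂ)) * Vᴴ := by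
    rw [sum_rankOne]
    congr 2
    ext x y
    rw [Matrix.sum_apply, Finset.sum_coe_sort S fun z => Matrix.vecMulVec (δ z) (star (δ z)) x y]
    simp only [Matrix.vecMulVec_apply, hδ, Pi.star_apply, Pi.single_apply, Matrix.diagonal_apply]
    by_cases hxy : x = y
    · subst hxy
      by_cases hx : x ∈ S <;> simp [hx]
    · simp [hxy]
  refine ⟨1 - ∑ x : S, rankOne V (δ x) ⊗ₖ rankOne W (δ x),
    one_sub_sum_mem_oneWayLOCC (fun x => posSemidef_rankOne V _) ?_
      (fun x => posSemidef_rankOne W _) (fun x => posSemidef_one_sub_rankOne hW (hunit x)), ?_, ?_⟩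
  · rw [hsum]
    refine posSemidef_one_sub_conj hV (posSemidef_one_sub_diagonal fun x => ?_)
    split_ifs <;> norm_num
  · rw [sub_sub_cancel, Matrix.trace_sum]
    simp [Matrix.trace_kronecker, trace_rankOne hV, trace_rankOne hW, hunit]
  · rw [sub_sub_cancel, expect_sum, ← Finset.sum_coe_sort S]
    refine Finset.sum_congr rfl fun x _ => ?_
    rw [expect_rankOne_kronecker hV hW, Finset.sum_eq_single (x : X)]
    · simp [hδ, Real.sq_sqrt (hlam x).le]
    · intro y _ hy
      simp [hδ, hy]
    · simp

/-- Alice filters to one of the sets `S ∈ F`, Bob measures in a Fourier basis of `S`, and Alice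
tests for the resulting conditional state. -/
theorem exists_roundTwo_test (hV : Vᴴ * V = 1) (hW : Wᴴ * W = 1) {lam : X → ℝ}
    (hlam : ∀ x, 0 < lam x) (F : Finset (Finset X)) {y : X → ℝ} (hne : ∀ S ∈ F, S.Nonempty)
    (hy : ∀ x, 0 < y x) (hcover : ∀ x, ∑ S ∈ F, (if x ∈ S then y x else 0) ≤ 1) :
    ∃ T ∈ roundLOCC ι κ 2,
      (1 - T).trace.re =
        ∑ S ∈ F, S.card * ((∑ x ∈ S, y x ^ 2 * lam x) / ∑ x ∈ S, y x * lam x) ∧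
      expect (schmidtVec V W fun x => √(lam x)) (1 - T) = ∑ S ∈ F, ∑ x ∈ S, y x * lam x := by
  choose b hb1 hb0 hb using fun S : F => exists_fourier_basis (hne S.1 S.2)
  let w : F → X → ℝ := fun S x => if x ∈ S.1 then √(y x) else 0
  let p : F → ℝ := fun S => ∑ x ∈ S.1, y x * lam x
  have hp : ∀ S : F, 0 < p S := fun S =>
    Finset.sum_pos (fun x _ => mul_pos (hy x) (hlam x)) (hne S.1 S.2)
  have hc : ∀ S : F, (0 : ℝ) < S.1.card := fun S => by
    exact_mod_cast Finset.card_pos.2 (hne S.1 S.2)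
  -- Alice's normalized conditional state, up to conjugation, after filter `S` and Bob's outcome
  -- `l`. As `|b S l x|` is constant on `S`, every outcome has probability `p S / |S|`, and the
  -- factor `√|S|` restores the norm.
  let a : ∀ S : F, Fin S.1.card → X → ℂ := fun S l x =>
    ((√(y x * lam x) / √(p S) * √(S.1.card : ℝ) : ℝ) : ℂ) * star (b S l x)
  have ha_norm : ∀ S l x, ‖a S l x‖ ^ 2 = y x * lam x / p S * S.1.card * ‖b S l x‖ ^ 2 := by
    intro S l x
    simp only [a]
    rw [norm_mul, mul_pow, norm_star, Complex.norm_real, Real.norm_eq_abs, sq_abs, mul_pow,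
      div_pow, Real.sq_sqrt (mul_pos (hy x) (hlam x)).le, Real.sq_sqrt (hp S).le,
      Real.sq_sqrt (hc S).le]
  have hsupp : ∀ (S : F) (l : Fin S.1.card) (g : X → ℝ),
      ∑ x, g x * ‖b S l x‖ ^ 2 = (∑ x ∈ S.1, g x) * (S.1.card : ℝ)⁻¹ := by
    intro S l g
    rw [← Finset.sum_subset (Finset.subset_univ S.1), Finset.sum_mul]
    · exact Finset.sum_congr rfl fun x hx => by rw [hb1 S l x hx]
    · intro x _ hx
      simp [hb0 S l x hx]
  have hunit : ∀ S l, ∑ x, ‖a S l x‖ ^ 2 = 1 := by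
    intro S l
    simp_rw [ha_norm]
    rw [hsupp, ← Finset.sum_mul, ← Finset.sum_div]
    have h1 := (hp S).ne'
    have h2 := (hc S).ne'
    change p S / p S * _ * _ = 1
    field_simp
  have hbunit : ∀ S l, ∑ x, ‖b S l x‖ ^ 2 = 1 := by
    intro S l
    have := hsupp S l fun _ => 1
    simp only [one_mul, Finset.sum_const, nsmul_eq_mul, mul_one] at this
    rw [this, mul_inv_cancel₀ (hc S).ne']
  let K : F → Matrix ι ι ℂ := fun S => V * Matrix.diagonal (fun x => (w S x : ℂ)) * Vᴴ
  have hKsum : (1 - ∑ S, (K S)ᴴ * K S).PosSemidef := by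
    have h : ∑ S, (K S)ᴴ * K S = V * Matrix.diagonal (fun x =>
        ((∑ S ∈ F, (if x ∈ S then y x else 0) : ℝ) : ℂ)) * Vᴴ := by
      have : ∀ S : F, (K S)ᴴ * K S = V * Matrix.diagonal (fun x =>
          ((if x ∈ S.1 then y x else 0 : ℝ) : ℂ)) * Vᴴ := by
        intro S
        rw [conj_diagonal_sq hV]
        congr 3
        ext x
        simp only [w]
        split_ifs
        · rw [Real.sq_sqrt (hy x).le]
        · simp
      simp_rw [this]
      rw [← Matrix.sum_mul, ← Matrix.mul_sum]
      congr 2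
      ext x z
      rw [Matrix.sum_apply]
      by_cases hxz : x = z
      · subst hxz
        simp only [Matrix.diagonal_apply_eq]
        rw [← Complex.ofReal_sum, Finset.sum_coe_sort F fun S => if x ∈ S then y x else 0]
      · simp [Matrix.diagonal_apply_ne _ hxz]
    rw [h]
    exact posSemidef_one_sub_conj hV (posSemidef_one_sub_diagonal hcover)
  have hBsum : ∀ S : F, (1 - ∑ l, rankOne W (b S l)).PosSemidef := by
    intro S
    have h : ∑ l, rankOne W (b S l) =
        W * Matrix.diagonal (fun x => ((if x ∈ S.1 then 1 else 0 : ℝ) : ℂ)) * Wᴴ := by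
      rw [sum_rankOne]
      congr 2
      ext x z
      rw [Matrix.sum_apply]
      simp only [Matrix.vecMulVec_apply, Pi.star_apply]
      rw [hb S x z, Matrix.diagonal_apply]
      by_cases hxz : x = z
      · subst hxz
        by_cases hx : x ∈ S.1 <;> simp [hx]
      · simp [hxz]
    rw [h]
    refine posSemidef_one_sub_conj hW (posSemidef_one_sub_diagonal fun x => ?_)
    split_ifs <;> norm_num
  have hKa : ∀ S l, (K S)ᴴ * rankOne V (a S l) * K S = rankOne V fun x => w S x * a S l x :=
    fun S l => conj_diagonal_rankOne hV (w S) (a S l)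
  refine ⟨_, one_sub_sum_mem_roundLOCC_two (K := K) (B := fun S l => rankOne W (b S l))
    (M := fun S l => rankOne V (a S l)) hKsum (fun S l => posSemidef_rankOne W _) hBsum
    (fun S l => posSemidef_rankOne V _) (fun S l => posSemidef_one_sub_rankOne hV (hunit S l)),
    ?_, ?_⟩
  · rw [sub_sub_cancel, Matrix.trace_sum, Complex.re_sum, ← Finset.sum_coe_sort F]
    refine Finset.sum_congr rfl fun S _ => ?_
    have hterm : ∀ l, (((K S)ᴴ * rankOne V (a S l) * K S) ⊗ₖ rankOne W (b S l)).trace.re =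
        (∑ x ∈ S.1, y x ^ 2 * lam x) / p S := by
      intro l
      rw [hKa, Matrix.trace_kronecker, trace_rankOne hV, trace_rankOne hW, hbunit,
        Complex.ofReal_one, mul_one, Complex.ofReal_re]
      have : ∀ x, ‖(w S x : ℂ) * a S l x‖ ^ 2 =
          (w S x ^ 2 * (y x * lam x / p S * S.1.card)) * ‖b S l x‖ ^ 2 := by
        intro x
        rw [norm_mul, mul_pow, ha_norm, Complex.norm_real, Real.norm_eq_abs, sq_abs]
        ring
      simp_rw [this]
      rw [hsupp, Finset.sum_mul, Finset.sum_div]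
      refine Finset.sum_congr rfl fun x hx => ?_
      simp only [w, if_pos hx, Real.sq_sqrt (hy x).le]
      have h1 := (hp S).ne'
      have h2 := (hc S).ne'
      field_simp
    rw [Matrix.trace_sum, Complex.re_sum, Finset.sum_congr rfl fun l _ => hterm l]
    simp [p]
  · rw [sub_sub_cancel, expect_sum, ← Finset.sum_coe_sort F]
    refine Finset.sum_congr rfl fun S _ => ?_
    have hterm : ∀ l, expect (schmidtVec V W fun x => √(lam x))
        (((K S)ᴴ * rankOne V (a S l) * K S) ⊗ₖ rankOne W (b S l)) =
        p S * (S.1.card : ℝ)⁻¹ := by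
      intro l
      rw [hKa, expect_rankOne_kronecker hV hW]
      have h : ∑ x, ((√(lam x) : ℝ) : ℂ) * ((w S x : ℂ) * a S l x * b S l x) =
          ((√(p S) * (√(S.1.card : ℝ))⁻¹ : ℝ) : ℂ) := by
        have hx : ∀ x, ((√(lam x) : ℝ) : ℂ) * ((w S x : ℂ) * a S l x * b S l x) =
            (((√(lam x) * w S x * (√(y x * lam x) / √(p S) * √(S.1.card : ℝ))) *
              ‖b S l x‖ ^ 2 : ℝ) : ℂ) := by
          intro x
          simp only [a, Complex.ofReal_mul, Complex.ofReal_pow]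
          rw [← Complex.conj_mul' (b S l x), Complex.star_def]
          ring
        rw [Finset.sum_congr rfl fun x _ => hx x, ← Complex.ofReal_sum, hsupp]
        congr 1
        have hx : ∀ x ∈ S.1, √(lam x) * w S x * (√(y x * lam x) / √(p S) * √(S.1.card : ℝ)) =
            (y x * lam x) * (√(S.1.card : ℝ) / √(p S)) := by
          intro x hx
          simp only [w, if_pos hx]
          have : √(lam x) * √(y x) = √(y x * lam x) := by
            rw [Real.sqrt_mul (hy x).le, mul_comm]
          rw [this]
          nth_rewrite 3 [← Real.mul_self_sqrt (mul_pos (hy x) (hlam x)).le]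
          ring
        rw [Finset.sum_congr rfl hx, ← Finset.sum_mul]
        change p S * _ * _ = _
        have h1 := (Real.sqrt_pos.2 (hp S)).ne'
        have h2 := (Real.sqrt_pos.2 (hc S)).ne'
        have e1 := Real.mul_self_sqrt (hp S).le
        have e2 := Real.mul_self_sqrt (hc S).le
        nth_rewrite 1 [← e1]
        nth_rewrite 2 [← e2]
        field_simp
      rw [h, Complex.norm_real, Real.norm_eq_abs, sq_abs, mul_pow, inv_pow,
        Real.sq_sqrt (hp S).le, Real.sq_sqrt (hc S).le]
    rw [expect_sum, Finset.sum_congr rfl fun l _ => hterm l]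
    simp only [Finset.sum_const, Finset.card_univ, Fintype.card_fin, nsmul_eq_mul, p]
    have h2 := (hc S).ne'
    field_simp

end Tests

/-! ### A symmetric family of filters -/

section Design

variable {X : Type} [Fintype X] [DecidableEq X]

/-- The subsets of `Y` that meet each level set of `lam` in a prescribed number of points. -/
def levelDesign (lam : X → ℝ) (Y : Finset X) (s : ℝ → ℕ) : Finset (Finset X) :=
  {S ∈ Y.powerset | ∀ v ∈ Y.image lam, (S.filter fun x => lam x = v).card = s v}

variable {lam : X → ℝ} {Y : Finset X} {s : ℝ → ℕ}

theorem mem_levelDesign {S : Finset X} : S ∈ levelDesign lam Y s ↔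
    S ⊆ Y ∧ ∀ v ∈ Y.image lam, (S.filter fun x => lam x = v).card = s v := by
  simp [levelDesign]

theorem levelDesign_nonempty
    (hs : ∀ v ∈ Y.image lam, s v ≤ (Y.filter fun x => lam x = v).card) :
    (levelDesign lam Y s).Nonempty := by
  have h : ∀ v, ∃ A ⊆ Y.filter (fun x => lam x = v), v ∈ Y.image lam → A.card = s v := by
    intro v
    by_cases hv : v ∈ Y.image lam
    · obtain ⟨A, hA, hc⟩ := Finset.exists_subset_card_eq (hs v hv)
      exact ⟨A, hA, fun _ => hc⟩
    · exact ⟨∅, Finset.empty_subset _, fun h => absurd h hv⟩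
  choose A hA hAc using h
  refine ⟨(Y.image lam).biUnion A, mem_levelDesign.2 ⟨?_, fun v hv => ?_⟩⟩
  · exact Finset.biUnion_subset.2 fun v _ => (hA v).trans (Finset.filter_subset _ _)
  · rw [← hAc v hv]
    congr 1
    ext x
    simp only [Finset.mem_filter, Finset.mem_biUnion]
    constructor
    · rintro ⟨⟨v', -, hx⟩, rfl⟩
      rwa [(Finset.mem_filter.1 (hA _ hx)).2]
    · exact fun hx => ⟨⟨v, hv, hx⟩, (Finset.mem_filter.1 (hA _ hx)).2⟩

theorem image_swap_mem_levelDesign {x x' : X} (hx : x ∈ Y) (hx' : x' ∈ Y)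
    (hxx : lam x = lam x') {S : Finset X} (hS : S ∈ levelDesign lam Y s) :
    S.image (Equiv.swap x x') ∈ levelDesign lam Y s := by
  have hlam : ∀ z, lam (Equiv.swap x x' z) = lam z := by
    intro z
    rw [Equiv.swap_apply_def]
    split_ifs with h1 h2
    · rw [h1, hxx]
    · rw [h2, hxx]
    · rfl
  obtain ⟨h1, h2⟩ := mem_levelDesign.1 hS
  refine mem_levelDesign.2 ⟨?_, fun v hv => ?_⟩
  · intro z hz
    obtain ⟨z', hz', rfl⟩ := Finset.mem_image.1 hz
    rw [Equiv.swap_apply_def]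
    split_ifs
    exacts [hx', hx, h1 hz']
  · rw [← h2 v hv, Finset.filter_image, Finset.card_image_of_injective _ (Equiv.injective _)]
    simp_rw [hlam]

/-- Swapping two points of one level set permutes the design, so both lie in equally many of its
members. -/
theorem card_levelDesign_mem_eq {x x' : X} (hx : x ∈ Y) (hx' : x' ∈ Y) (hxx : lam x = lam x') :
    ((levelDesign lam Y s).filter fun S => x ∈ S).card =
      ((levelDesign lam Y s).filter fun S => x' ∈ S).card := by
  have hinv : ∀ S : Finset X, (S.image (Equiv.swap x x')).image (Equiv.swap x x') = S := by
    intro S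
    ext z
    simp only [Finset.mem_image, exists_exists_and_eq_and, Equiv.swap_apply_self, exists_eq_right]
  refine Finset.card_nbij' (fun S => S.image (Equiv.swap x x'))
    (fun S => S.image (Equiv.swap x x')) ?_ ?_ (fun S _ => hinv S) (fun S _ => hinv S)
  · intro S hS
    have hS := Finset.mem_filter.1 hS
    refine Finset.mem_filter.2 ⟨image_swap_mem_levelDesign hx hx' hxx hS.1, ?_⟩
    exact Finset.mem_image.2 ⟨x, hS.2, Equiv.swap_apply_left x x'⟩
  · intro S hS
    have hS := Finset.mem_filter.1 hS
    refine Finset.mem_filter.2 ⟨image_swap_mem_levelDesign hx hx' hxx hS.1, ?_⟩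
    exact Finset.mem_image.2 ⟨x', hS.2, Equiv.swap_apply_right x x'⟩

/-- Double counting of incidences between the level of `x` and the design, using that all points of
a level are covered equally often. -/
theorem card_level_mul_card_levelDesign_mem {x : X} (hx : x ∈ Y) :
    (Y.filter fun z => lam z = lam x).card *
      ((levelDesign lam Y s).filter fun S => x ∈ S).card =
      (levelDesign lam Y s).card * s (lam x) := by
  have h1 : ∑ z ∈ Y.filter (fun z => lam z = lam x),
      ((levelDesign lam Y s).filter fun S => z ∈ S).card =
      ∑ S ∈ levelDesign lam Y s, (S.filter fun z => lam z = lam x).card := by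
    simp_rw [Finset.card_filter (fun S => _ ∈ S)]
    rw [Finset.sum_comm]
    refine Finset.sum_congr rfl fun S hS => ?_
    rw [← Finset.card_filter, Finset.filter_filter]
    congr 1
    ext z
    simp only [Finset.mem_filter]
    constructor
    · exact fun h => ⟨h.2.2, h.2.1⟩
    · exact fun h => ⟨(mem_levelDesign.1 hS).1 h.1, h.2, h.1⟩
  rw [Finset.sum_congr rfl fun z hz => card_levelDesign_mem_eq (Finset.mem_filter.1 hz).1 hx
      (Finset.mem_filter.1 hz).2,
    Finset.sum_congr rfl fun S hS => (mem_levelDesign.1 hS).2 _ (Finset.mem_image_of_mem lam hx),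
    Finset.sum_const, Finset.sum_const] at h1
  simpa using h1

theorem sum_comp_of_mem_levelDesign {S : Finset X} (hS : S ∈ levelDesign lam Y s) (g : ℝ → ℝ) :
    ∑ x ∈ S, g (lam x) = ∑ v ∈ Y.image lam, s v * g v := by
  obtain ⟨h1, h2⟩ := mem_levelDesign.1 hS
  rw [← Finset.sum_fiberwise_of_maps_to
    (fun x hx => Finset.mem_image_of_mem lam (h1 hx)) fun x => g (lam x)]
  refine Finset.sum_congr rfl fun v hv => ?_
  rw [Finset.sum_congr rfl fun x hx => by rw [(Finset.mem_filter.1 hx).2], Finset.sum_const,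
    h2 v hv, nsmul_eq_mul]

theorem sum_comp_eq_sum_image (g : ℝ → ℝ) :
    ∑ x ∈ Y, g (lam x) =
      ∑ v ∈ Y.image lam, ((Y.filter fun x => lam x = v).card : ℝ) * g v := by
  rw [← Finset.sum_fiberwise_of_maps_to
    (fun x hx => Finset.mem_image_of_mem lam hx) fun x => g (lam x)]
  refine Finset.sum_congr rfl fun v hv => ?_
  rw [Finset.sum_congr rfl fun x hx => by rw [(Finset.mem_filter.1 hx).2], Finset.sum_const,
    nsmul_eq_mul]

/-- A design whose filtered sets represent the distribution `∝ √λ` on the level sets of `λ`. -/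
theorem exists_filter_design (hlam : ∀ x, 0 < lam x) (hY : Y.Nonempty) :
    ∃ (F : Finset (Finset X)) (y : X → ℝ), (∀ S ∈ F, S.Nonempty) ∧ (∀ x, 0 < y x) ∧
      (∀ x, ∑ S ∈ F, (if x ∈ S then y x else 0) = if x ∈ Y then 1 else 0) ∧
      ∑ S ∈ F, S.card * ((∑ x ∈ S, y x ^ 2 * lam x) / ∑ x ∈ S, y x * lam x) ≤
        (1 + ((Y.image lam).card : ℝ)) * (∑ x ∈ Y, √(lam x)) ^ 2 / ∑ x ∈ Y, lam x := by
  obtain ⟨z, hz, hmax⟩ := Y.exists_max_image lam hY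
  set τ := √(lam z) with hτ
  have hτ0 : 0 < τ := Real.sqrt_pos.2 (hlam z)
  set m : ℝ → ℕ := fun v => (Y.filter fun x => lam x = v).card with hm
  have hm0 : ∀ v ∈ Y.image lam, 0 < m v := by
    intro v hv
    obtain ⟨x, hx, rfl⟩ := Finset.mem_image.1 hv
    exact Finset.card_pos.2 ⟨x, Finset.mem_filter.2 ⟨hx, rfl⟩⟩
  have hv0 : ∀ v ∈ Y.image lam, 0 < v ∧ √v ≤ τ := by
    intro v hv
    obtain ⟨x, hx, rfl⟩ := Finset.mem_image.1 hv
    exact ⟨hlam x, Real.sqrt_le_sqrt (hmax x hx)⟩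
  -- The number of points kept from a level is proportional to its share of `∑ √λ`. Normalizing by
  -- the largest `√λ` ensures `s v ≤ m v`.
  set s : ℝ → ℕ := fun v => ⌈(m v : ℝ) * √v / τ⌉₊ with hs
  have hsm : ∀ v ∈ Y.image lam, s v ≤ m v := by
    intro v hv
    refine Nat.ceil_le.2 ?_
    rw [div_le_iff₀ hτ0]
    exact mul_le_mul_of_nonneg_left (hv0 v hv).2 (Nat.cast_nonneg _)
  have hs0 : ∀ v ∈ Y.image lam, 0 < s v := by
    intro v hv
    have h1 : (0 : ℝ) < m v := by exact_mod_cast hm0 v hv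
    have h2 := Real.sqrt_pos.2 (hv0 v hv).1
    exact Nat.ceil_pos.2 (by positivity)
  set F := levelDesign lam Y s with hF
  have hFne : F.Nonempty := levelDesign_nonempty hsm
  have hN : (0 : ℝ) < F.card := by exact_mod_cast Finset.card_pos.2 hFne
  -- The reciprocal of the number of design sets containing a given point of level `v`, so the
  -- filters sum to the projection onto `Y`.
  set η : ℝ → ℝ := fun v => (m v : ℝ) / (F.card * s v) with hη
  set y : X → ℝ := fun x => if x ∈ Y then η (lam x) else 1 with hy
  have hη0 : ∀ v ∈ Y.image lam, 0 < η v := by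
    intro v hv
    have h1 : (0 : ℝ) < m v := by exact_mod_cast hm0 v hv
    have h2 : (0 : ℝ) < s v := by exact_mod_cast hs0 v hv
    simp only [hη]
    positivity
  have hcard : ∀ S ∈ F, (S.card : ℝ) = ∑ v ∈ Y.image lam, (s v : ℝ) := by
    intro S hS
    have := sum_comp_of_mem_levelDesign hS fun _ => 1
    simpa using this
  have hsub : ∀ S ∈ F, S ⊆ Y := fun S hS => (mem_levelDesign.1 hS).1
  have hcard0 : 0 < ∑ v ∈ Y.image lam, (s v : ℝ) :=
    Finset.sum_pos (fun v hv => by exact_mod_cast hs0 v hv) (hY.image lam)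
  have hyS : ∀ S ∈ F, ∑ x ∈ S, y x * lam x = (∑ x ∈ Y, lam x) / F.card := by
    intro S hS
    have h1 : ∑ x ∈ S, y x * lam x = ∑ x ∈ S, (fun v => η v * v) (lam x) :=
      Finset.sum_congr rfl fun x hx => by simp only [hy, if_pos (hsub S hS hx)]
    rw [h1, sum_comp_of_mem_levelDesign hS fun v => η v * v,
      sum_comp_eq_sum_image (lam := lam) (Y := Y) fun v => v, Finset.sum_div]
    refine Finset.sum_congr rfl fun v hv => ?_
    have h2 : (s v : ℝ) ≠ 0 := by exact_mod_cast (hs0 v hv).ne'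
    simp only [hη, hm]
    field_simp
  have hyS2 : ∀ S ∈ F, ∑ x ∈ S, y x ^ 2 * lam x =
      (∑ v ∈ Y.image lam, (m v : ℝ) ^ 2 * v / s v) / (F.card : ℝ) ^ 2 := by
    intro S hS
    have h1 : ∑ x ∈ S, y x ^ 2 * lam x = ∑ x ∈ S, (fun v => η v ^ 2 * v) (lam x) :=
      Finset.sum_congr rfl fun x hx => by simp only [hy, if_pos (hsub S hS hx)]
    rw [h1, sum_comp_of_mem_levelDesign hS fun v => η v ^ 2 * v, Finset.sum_div]
    refine Finset.sum_congr rfl fun v hv => ?_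
    have h2 : (s v : ℝ) ≠ 0 := by exact_mod_cast (hs0 v hv).ne'
    simp only [hη]
    field_simp
  have hp : 0 < ∑ x ∈ Y, lam x := Finset.sum_pos (fun x _ => hlam x) hY
  refine ⟨F, y, fun S hS => ?_, fun x => ?_, fun x => ?_, ?_⟩
  · rw [← Finset.card_pos]
    have := hcard S hS ▸ hcard0
    exact_mod_cast this
  · simp only [hy]
    split_ifs with hx
    · exact hη0 _ (Finset.mem_image_of_mem lam hx)
    · exact one_pos
  · rw [← Finset.sum_filter, Finset.sum_const, nsmul_eq_mul]
    split_ifs with hx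
    · have h := card_level_mul_card_levelDesign_mem (lam := lam) (s := s) hx
      have h' : (m (lam x) : ℝ) * ((F.filter fun S => x ∈ S).card : ℝ) = F.card * s (lam x) := by
        exact_mod_cast h
      have h2 : (s (lam x) : ℝ) ≠ 0 := by
        exact_mod_cast (hs0 _ (Finset.mem_image_of_mem lam hx)).ne'
      simp only [hy, if_pos hx, hη]
      rw [mul_div_assoc', mul_comm, h', div_self (mul_ne_zero hN.ne' h2)]
    · have : F.filter (fun S => x ∈ S) = ∅ :=
        Finset.filter_eq_empty_iff.2 fun S hS hxS => hx (hsub S hS hxS)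
      simp [this]
  · set R := ∑ x ∈ Y, √(lam x) with hR
    have hR' : R = ∑ v ∈ Y.image lam, (m v : ℝ) * √v := sum_comp_eq_sum_image Real.sqrt
    have hτR : τ ≤ R := Finset.single_le_sum (f := fun x => √(lam x))
      (fun x _ => Real.sqrt_nonneg _) hz
    have hQ : ∑ v ∈ Y.image lam, (m v : ℝ) ^ 2 * v / s v ≤ τ * R := by
      rw [hR', Finset.mul_sum]
      refine Finset.sum_le_sum fun v hv => ?_
      have h2 : (0 : ℝ) < s v := by exact_mod_cast hs0 v hv
      have h3 : (m v : ℝ) * √v ≤ τ * s v := by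
        have := Nat.le_ceil ((m v : ℝ) * √v / τ)
        rwa [div_le_iff₀ hτ0, mul_comm _ τ] at this
      rw [div_le_iff₀ h2]
      have h4 : √v * √v = v := Real.mul_self_sqrt (hv0 v hv).1.le
      have h5 : 0 ≤ (m v : ℝ) * √v := mul_nonneg (Nat.cast_nonneg _) (Real.sqrt_nonneg _)
      calc (m v : ℝ) ^ 2 * v = (m v * √v) * (m v * √v) := by
            rw [mul_mul_mul_comm, h4, sq]
        _ ≤ (m v * √v) * (τ * s v) := mul_le_mul_of_nonneg_left h3 h5
        _ = _ := by ring
    -- Rounding up costs at most one point per level, and `τ ≤ R` absorbs each of them; this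
    -- produces the factor counting levels.
    have hC : τ * ∑ v ∈ Y.image lam, (s v : ℝ) ≤ (1 + ((Y.image lam).card : ℝ)) * R := by
      have h1 : ∑ v ∈ Y.image lam, (s v : ℝ) ≤ R / τ + (Y.image lam).card := by
        calc ∑ v ∈ Y.image lam, (s v : ℝ) ≤ ∑ v ∈ Y.image lam, ((m v : ℝ) * √v / τ + 1) := by
              exact Finset.sum_le_sum fun v hv => (Nat.ceil_lt_add_one (div_nonneg
                (mul_nonneg (Nat.cast_nonneg _) (Real.sqrt_nonneg _)) hτ0.le)).le
          _ = _ := by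
              rw [Finset.sum_add_distrib, ← Finset.sum_div, ← hR']
              simp
      calc τ * ∑ v ∈ Y.image lam, (s v : ℝ) ≤ τ * (R / τ + (Y.image lam).card) := by gcongr
        _ = R + (Y.image lam).card * τ := by field_simp
        _ ≤ R + (Y.image lam).card * R := by gcongr
        _ = _ := by ring
    have hsumF : ∑ S ∈ F, S.card * ((∑ x ∈ S, y x ^ 2 * lam x) / ∑ x ∈ S, y x * lam x) =
        (∑ v ∈ Y.image lam, (s v : ℝ)) * (∑ v ∈ Y.image lam, (m v : ℝ) ^ 2 * v / s v) /
          ∑ x ∈ Y, lam x := by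
      rw [Finset.sum_congr rfl fun S hS => by rw [hcard S hS, hyS S hS, hyS2 S hS],
        Finset.sum_const, nsmul_eq_mul]
      have := hp.ne'
      field_simp
    rw [hsumF]
    refine div_le_div_of_nonneg_right ?_ hp.le
    calc (∑ v ∈ Y.image lam, (s v : ℝ)) * (∑ v ∈ Y.image lam, (m v : ℝ) ^ 2 * v / s v)
        ≤ (∑ v ∈ Y.image lam, (s v : ℝ)) * (τ * R) := mul_le_mul_of_nonneg_left hQ hcard0.le
      _ = (τ * ∑ v ∈ Y.image lam, (s v : ℝ)) * R := by ring
      _ ≤ ((1 + ((Y.image lam).card : ℝ)) * R) * R :=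
          mul_le_mul_of_nonneg_right hC (hτ0.le.trans hτR)
      _ = _ := by ring

end Design

/-- The one-shot achievability for two rounds of communication. -/
theorem exists_roundTwo_test_le {ι κ X : Type} [Fintype ι] [Fintype κ] [Fintype X]
    [DecidableEq ι] [DecidableEq κ] [DecidableEq X] {V : Matrix ι X ℂ} {W : Matrix κ X ℂ}
    (hV : Vᴴ * V = 1) (hW : Wᴴ * W = 1) {lam : X → ℝ} (hlam : ∀ x, 0 < lam x)
    {Y : Finset X} (hY : Y.Nonempty) :
    ∃ T ∈ roundLOCC ι κ 2,
      (1 - T).trace.re ≤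
        (1 + ((Y.image lam).card : ℝ)) * (∑ x ∈ Y, √(lam x)) ^ 2 / ∑ x ∈ Y, lam x ∧
      expect (schmidtVec V W fun x => √(lam x)) (1 - T) = ∑ x ∈ Y, lam x := by
  obtain ⟨F, y, hne, hy, hcover, hbound⟩ := exists_filter_design hlam hY
  obtain ⟨T, hT, htr, hex⟩ := exists_roundTwo_test hV hW hlam F hne hy fun x => by
    rw [hcover]; split_ifs <;> norm_num
  refine ⟨T, hT, htr ▸ hbound, ?_⟩
  rw [hex]
  calc ∑ S ∈ F, ∑ x ∈ S, y x * lam x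
      = ∑ S ∈ F, ∑ x, (if x ∈ S then y x else 0) * lam x := by
        refine Finset.sum_congr rfl fun S _ => ?_
        simp [ite_mul, Finset.sum_ite_mem]
    _ = ∑ x ∈ Y, lam x := by
        rw [Finset.sum_comm]
        simp_rw [← Finset.sum_mul, hcover]
        simp [ite_mul, Finset.sum_ite_mem]

/-! ### Asymptotic bounds at the critical parameter -/

section Asymptotics

variable {X : Type} [Fintype X] [DecidableEq X] {lam : X → ℝ}

theorem eventually_poly_le_exp (d : ℕ) {η : ℝ} (hη : 0 < η) :
    ∀ᶠ n : ℕ in Filter.atTop, 2 * (1 + ((n : ℝ) + 1) ^ d) ≤ Real.exp (n * η) := by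
  have h := (isLittleO_pow_exp_pos_mul_atTop (k := d) hη).bound
    (show 0 < Real.exp (-η) / 4 by positivity)
  have ht : Filter.Tendsto (fun n : ℕ => (n : ℝ) + 1) Filter.atTop Filter.atTop :=
    Filter.tendsto_atTop_add_const_right _ _ tendsto_natCast_atTop_atTop
  filter_upwards [ht.eventually h] with n hn
  have h0 : (0 : ℝ) ≤ n := Nat.cast_nonneg n
  have h1 : (1 : ℝ) ≤ ((n : ℝ) + 1) ^ d := one_le_pow₀ (by linarith)
  rw [Real.norm_of_nonneg (by positivity), Real.norm_of_nonneg (Real.exp_pos _).le] at hn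
  have e : Real.exp (-η) / 4 * Real.exp (η * ((n : ℝ) + 1)) = Real.exp (n * η) / 4 := by
    rw [div_mul_eq_mul_div, ← Real.exp_add]
    congr 2
    ring
  rw [e] at hn
  linarith

/-- A set of sequences of weight at least `1 - e^{-n r}` on which the power sum of order `a` is
small. -/
theorem exists_cutoff [Nonempty X] (hlam : ∀ x, 0 < lam x) {a r θ₀ : ℝ}
    (h : IsCritical lam a r θ₀) (n : ℕ) :
    ∃ Y : Finset (Fin n → X), ∑ x ∈ Yᶜ, prodWeight lam n x ≤ Real.exp (-(n * r)) ∧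
      ∑ x ∈ Y, prodWeight lam n x ^ a ≤
        Real.exp (n * (Real.log (powSum lam θ₀) + (θ₀ - a) * tiltedSurprisal lam θ₀)) := by
  obtain ⟨ha, h1, hD | ⟨rfl, -⟩, -⟩ := h
  -- At the cutoff `u(θ₀)` the Chernoff exponent of the discarded weight is exactly `D(θ₀) = r`. In
  -- the boundary case `θ₀ = a` nothing is discarded.
  · refine ⟨heavy lam n (tiltedSurprisal lam θ₀), ?_, sum_heavy_rpow_le hlam n _ ha⟩
    have := sum_light_rpow_le hlam n (tiltedSurprisal lam θ₀) h1.le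
    simp only [Real.rpow_one] at this
    refine this.trans (Real.exp_le_exp.2 (le_of_eq ?_))
    rw [← hD, tiltedDivergence]
    ring
  · refine ⟨Finset.univ, ?_, ?_⟩
    · simpa using (Real.exp_pos _).le
    · rw [sum_prodWeight_rpow_exp hlam]
      simp

theorem sum_prodWeight (hsum : ∑ x, lam x = 1) (n : ℕ) : ∑ x, prodWeight lam n x = 1 := by
  have := Fintype.sum_pow lam n
  rw [hsum, one_pow] at this
  exact this.symm

/-- Moving slightly right of `θ₀` makes the divergence strictly less than `r`, at an arbitrarily
small loss in any continuous rate `g`. The converses need this room. -/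
theorem IsCritical.exists_lt {a r θ₀ : ℝ} (h : IsCritical lam a r θ₀) (ha : 0 ≤ a)
    {g : ℝ → ℝ} (hg : Continuous g) {η : ℝ} (hη : 0 < η) :
    ∃ θ, 0 ≤ θ ∧ θ < 1 ∧ tiltedDivergence lam θ < r ∧ g θ₀ - η < g θ := by
  obtain ⟨ha', h1, -, hlt⟩ := h
  have e : ∀ᶠ θ in nhdsWithin θ₀ (Set.Ioi θ₀), g θ₀ - η < g θ :=
    (hg.continuousAt.tendsto.mono_left nhdsWithin_le_nhds).eventually
      (lt_mem_nhds (by linarith))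
  obtain ⟨θ, h2, h3⟩ := (e.and (Ioo_mem_nhdsGT h1)).exists
  exact ⟨θ, (ha.trans ha').trans h3.1.le, h3.2, hlt θ h3.1 h3.2, h2⟩

/-- Take `S` heavy at `u(θ) + δ` with `D(θ) < r`. Then `√e √|S|` is at most half of the lower bound
for `∑_S √λ`, so `t` is at least about `|S|^2 e^{-nu}`, which has rate `2H - u = H - D`. -/
theorem eventually_le_of_sum_sqrt_le [Nonempty X] (hlam : ∀ x, 0 < lam x) {r θ₀ : ℝ}
    (h : IsCritical lam (1 / 2) r θ₀) {η : ℝ} (hη : 0 < η) :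
    ∀ᶠ n : ℕ in Filter.atTop, ∀ t e : ℝ, e ≤ Real.exp (-(n * r)) →
      (∀ S : Finset (Fin n → X),
        ∑ x ∈ S, √(prodWeight lam n x) ≤ √t + √e * √(S.card : ℝ)) →
      Real.exp (n * (tiltedEntropy lam θ₀ - tiltedDivergence lam θ₀ - η)) ≤ t := by
  obtain ⟨θ, hθ0, hθ1, hD, hg⟩ := h.exists_lt (by norm_num)
    ((continuous_tiltedEntropy hlam).sub (continuous_tiltedDivergence hlam)) (half_pos hη)
  simp only [Pi.sub_apply] at hg
  set H := tiltedEntropy lam θ with hH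
  set u := tiltedSurprisal lam θ with hu
  set D := tiltedDivergence lam θ with hDdef
  have hDu : D = u - H := by
    rw [hDdef, hH, tiltedDivergence, tiltedEntropy]; ring
  obtain ⟨δ, hδ0, hδ1, hδ2⟩ : ∃ δ, 0 < δ ∧ 4 * δ ≤ r - D ∧ 8 * δ ≤ η := by
    refine ⟨min (r - D) η / 8, ?_, ?_, ?_⟩
    · have := lt_min (sub_pos.2 hD) hη
      linarith
    · have := lt_min (sub_pos.2 hD) hη
      have := min_le_left (r - D) η
      linarith
    · have := min_le_right (r - D) η
      linarith
  filter_upwards [eventually_card_heavy_ge hlam hθ0 hθ1.le hδ0,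
    eventually_exp_neg_le hδ0 (show (0 : ℝ) < 1 / 4 by norm_num)] with n hcard hsmall t e he hS
  have hn : (0 : ℝ) ≤ n := Nat.cast_nonneg n
  set S := heavy lam n (u + δ) with hSdef
  have hS := hS S
  set q := √(S.card : ℝ) with hq
  set A := Real.exp (-(n * (u + δ)) / 2) with hA
  have hA0 : 0 < A := Real.exp_pos _
  have hq2 : q * q = S.card := Real.mul_self_sqrt (Nat.cast_nonneg _)
  have hqge : Real.exp (n * (H - δ) / 2) ≤ q := by
    rw [Real.exp_half]
    exact Real.sqrt_le_sqrt hcard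
  have hq0 : 0 < q := (Real.exp_pos _).trans_le hqge
  have hlow : q * q * A ≤ ∑ x ∈ S, √(prodWeight lam n x) := by
    rw [hq2, ← nsmul_eq_mul, ← Finset.sum_const]
    refine Finset.sum_le_sum fun x hx => ?_
    rw [hA, Real.exp_half]
    exact Real.sqrt_le_sqrt (mem_heavy.1 hx)
  have he' : √e ≤ q * A / 2 := by
    have h1 : √e ≤ Real.exp (-(n * r) / 2) := by
      rw [Real.exp_half]
      exact Real.sqrt_le_sqrt he
    have h2 : Real.exp (-(n * r) / 2) ≤ Real.exp (n * (H - δ) / 2) * A * Real.exp (-(n * δ)) := by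
      rw [hA, ← Real.exp_add, ← Real.exp_add]
      refine Real.exp_le_exp.2 ?_
      have : (n : ℝ) * (4 * δ) ≤ n * (r - D) := mul_le_mul_of_nonneg_left hδ1 hn
      rw [hDu] at this
      linarith
    have h3 : Real.exp (n * (H - δ) / 2) * A * Real.exp (-(n * δ)) ≤ q * A * (1 / 4) := by
      gcongr
    have : 0 < q * A := mul_pos hq0 hA0
    linarith
  have ht : q * q * A / 2 ≤ √t := by
    have := mul_le_mul_of_nonneg_right he' hq0.le
    linarith
  have htpos : 0 < t := Real.sqrt_pos.1 ((by positivity : 0 < q * q * A / 2).trans_le ht)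
  have hsq : (q * q * A / 2) ^ 2 ≤ t := by
    rw [← Real.sq_sqrt htpos.le]
    gcongr
  refine le_trans ?_ hsq
  have h5 : Real.exp (n * (H - δ)) ≤ q * q := hq2 ▸ hcard
  have h6 : (Real.exp (n * (H - δ)) * A) ^ 2 / 4 ≤ (q * q * A / 2) ^ 2 := by
    have : (q * q * A / 2) ^ 2 = (q * q * A) ^ 2 / 4 := by ring
    rw [this]
    gcongr
  refine le_trans ?_ h6
  have h7 : (Real.exp (n * (H - δ)) * A) ^ 2 = Real.exp (n * (H - D - 3 * δ)) := by
    rw [hA, ← Real.exp_add, ← Real.exp_nat_mul]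
    congr 1
    rw [hDu]
    push_cast
    ring
  rw [h7]
  have h8 : Real.exp (n * (tiltedEntropy lam θ₀ - tiltedDivergence lam θ₀ - η)) ≤
      Real.exp (n * (H - D - 3 * δ)) * Real.exp (-(n * δ)) := by
    rw [← Real.exp_add]
    refine Real.exp_le_exp.2 ?_
    have : (n : ℝ) * (tiltedEntropy lam θ₀ - tiltedDivergence lam θ₀ - η) ≤
        n * (H - D - 4 * δ) := mul_le_mul_of_nonneg_left (by linarith) hn
    linarith
  have h9 := mul_le_mul_of_nonneg_left hsmall (Real.exp_pos (n * (H - D - 3 * δ))).le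
  linarith

/-- On the heavy set every missed sequence costs about `e^{-nu}`, so error `e^{-nr}` with `r > D = u
- H` allows missing only a vanishing fraction of its roughly `e^{nH}` elements. -/
theorem eventually_le_of_classical_test [Nonempty X] (hlam : ∀ x, 0 < lam x) {r θ₀ : ℝ}
    (h : IsCritical lam 0 r θ₀) {η : ℝ} (hη : 0 < η) :
    ∀ᶠ n : ℕ in Filter.atTop, ∀ (t : (Fin n → X) → ℝ), (∀ x, 0 ≤ t x) → (∀ x, t x ≤ 1) →
      ∑ x, prodWeight lam n x * (1 - t x) ≤ Real.exp (-(n * r)) →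
      Real.exp (n * (tiltedEntropy lam θ₀ - η)) ≤ ∑ x, t x := by
  obtain ⟨θ, hθ0, hθ1, hD, hg⟩ := h.exists_lt le_rfl (continuous_tiltedEntropy hlam) (half_pos hη)
  set H := tiltedEntropy lam θ with hH
  set u := tiltedSurprisal lam θ with hu
  set D := tiltedDivergence lam θ with hDdef
  have hDu : D = u - H := by
    rw [hDdef, hH, tiltedDivergence, tiltedEntropy]; ring
  obtain ⟨δ, hδ0, hδ1, hδ2⟩ : ∃ δ, 0 < δ ∧ 4 * δ ≤ r - D ∧ 8 * δ ≤ η := by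
    refine ⟨min (r - D) η / 8, ?_, ?_, ?_⟩
    · have := lt_min (sub_pos.2 hD) hη
      linarith
    · have := lt_min (sub_pos.2 hD) hη
      have := min_le_left (r - D) η
      linarith
    · have := min_le_right (r - D) η
      linarith
  filter_upwards [eventually_card_heavy_ge hlam hθ0 hθ1.le hδ0,
    eventually_exp_neg_le hδ0 (show (0 : ℝ) < 1 / 4 by norm_num)] with n hcard hsmall t h0 h1 ht
  have hn : (0 : ℝ) ≤ n := Nat.cast_nonneg n
  set S := heavy lam n (u + δ) with hSdef
  have hrest : Real.exp (-(n * (u + δ))) * ∑ x ∈ S, (1 - t x) ≤ Real.exp (-(n * r)) := by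
    refine le_trans ?_ ht
    rw [Finset.mul_sum]
    refine le_trans (Finset.sum_le_sum fun x hx => ?_)
      (Finset.sum_le_sum_of_subset_of_nonneg (Finset.subset_univ S) fun x _ _ =>
        mul_nonneg (prodWeight_pos hlam n x).le (sub_nonneg.2 (h1 x)))
    exact mul_le_mul_of_nonneg_right (mem_heavy.1 hx) (sub_nonneg.2 (h1 x))
  have hrest' : ∑ x ∈ S, (1 - t x) ≤ Real.exp (n * (H - δ)) * Real.exp (-(n * δ)) := by
    refine le_of_mul_le_mul_left (hrest.trans ?_) (Real.exp_pos (-(n * (u + δ))))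
    rw [← Real.exp_add, ← Real.exp_add]
    refine Real.exp_le_exp.2 ?_
    have : (n : ℝ) * (4 * δ) ≤ n * (r - D) := mul_le_mul_of_nonneg_left hδ1 hn
    have h' : 0 ≤ (n : ℝ) * δ := mul_nonneg hn hδ0.le
    rw [hDu] at this
    linarith
  have h9 := mul_le_mul_of_nonneg_left hsmall (Real.exp_pos (n * (H - δ))).le
  have hE := Real.exp_pos (n * (H - δ))
  have hsumS : (S.card : ℝ) - ∑ x ∈ S, (1 - t x) = ∑ x ∈ S, t x := by
    rw [Finset.sum_sub_distrib]; simp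
  have hle : ∑ x ∈ S, t x ≤ ∑ x, t x :=
    Finset.sum_le_sum_of_subset_of_nonneg (Finset.subset_univ S) fun x _ _ => h0 x
  have h8 : Real.exp (n * (tiltedEntropy lam θ₀ - η)) ≤
      Real.exp (n * (H - δ)) * Real.exp (-(n * δ)) := by
    rw [← Real.exp_add]
    refine Real.exp_le_exp.2 ?_
    have : (n : ℝ) * (tiltedEntropy lam θ₀ - η) ≤ n * (H - 2 * δ) :=
      mul_le_mul_of_nonneg_left (by linarith) hn
    linarith
  linarith

end Asymptotics

/-! ### Schmidt decomposition -/

section Schmidt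

variable {ι κ : Type} [Fintype ι] [Fintype κ] [DecidableEq ι] [DecidableEq κ]

/-- The nonzero squared Schmidt coefficients. -/
def nonzeroSchmidt (Ψ : EuclideanSpace ℂ (ι × κ)) (x : {i // schmidt Ψ i ≠ 0}) : ℝ :=
  schmidt Ψ x

theorem sum_nonzeroSchmidt_comp (Ψ : EuclideanSpace ℂ (ι × κ)) (g : ℝ → ℝ) :
    ∑ x, g (nonzeroSchmidt Ψ x) = ∑ i with schmidt Ψ i ≠ 0, g (schmidt Ψ i) :=
  (Finset.sum_subtype _ (by simp) fun i => g (schmidt Ψ i)).symm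

theorem reducedState_eq (Ψ : EuclideanSpace ℂ (ι × κ)) :
    reducedState Ψ = (Matrix.of fun a b => Ψ (a, b)) * (Matrix.of fun a b => Ψ (a, b))ᴴ := by
  ext a a'
  simp [reducedState, pureState, Matrix.mul_apply]

theorem posSemidef_reducedState (Ψ : EuclideanSpace ℂ (ι × κ)) :
    (reducedState Ψ).PosSemidef := by
  rw [reducedState_eq]
  exact Matrix.posSemidef_self_mul_conjTranspose _

theorem nonzeroSchmidt_pos (Ψ : EuclideanSpace ℂ (ι × κ)) (x : {i // schmidt Ψ i ≠ 0}) :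
    0 < nonzeroSchmidt Ψ x :=
  lt_of_le_of_ne ((posSemidef_reducedState Ψ).eigenvalues_nonneg x.1) x.2.symm

theorem sum_nonzeroSchmidt {Ψ : EuclideanSpace ℂ (ι × κ)} (hΨ : ‖Ψ‖ = 1) :
    ∑ x, nonzeroSchmidt Ψ x = 1 := by
  have h1 := sum_nonzeroSchmidt_comp Ψ fun v => v
  rw [h1, Finset.sum_filter_ne_zero]
  have h2 := (reducedState_isHermitian Ψ).trace_eq_sum_eigenvalues
  have h3 : (reducedState Ψ).trace = 1 := by
    have h4 : (reducedState Ψ).trace = ((‖Ψ‖ ^ 2 : ℝ) : ℂ) := by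
      rw [EuclideanSpace.norm_sq_eq, Fintype.sum_prod_type, Matrix.trace]
      push_cast
      refine Finset.sum_congr rfl fun a _ => ?_
      simp only [Matrix.diag, reducedState, pureState, Matrix.of_apply]
      exact Finset.sum_congr rfl fun b _ => Complex.mul_conj' _
    rw [h4, hΨ]
    simp
  rw [h3] at h2
  have h5 : ((∑ i, schmidt Ψ i : ℝ) : ℂ) = 1 := by
    rw [h2]
    push_cast
    rfl
  exact_mod_cast h5

/-- Diagonalizing `M Mᴴ` by `U` makes the rows of `Uᴴ M` orthogonal with squared norms `schmidt Ψ`.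
Zero rows drop out, and the other rows, normalized, give the columns of `W`. -/
theorem exists_schmidt_decomposition (Ψ : EuclideanSpace ℂ (ι × κ)) :
    ∃ (V : Matrix ι {i // schmidt Ψ i ≠ 0} ℂ) (W : Matrix κ {i // schmidt Ψ i ≠ 0} ℂ),
      Vᴴ * V = 1 ∧ Wᴴ * W = 1 ∧ ∀ p, Ψ p = schmidtVec V W (fun x => √(nonzeroSchmidt Ψ x)) p := by
  set M : Matrix ι κ ℂ := Matrix.of fun a b => Ψ (a, b) with hM
  set U : Matrix ι ι ℂ := (reducedState_isHermitian Ψ).eigenvectorUnitary.1 with hU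
  have hUU : Uᴴ * U = 1 := Unitary.coe_star_mul_self _
  have hUU' : U * Uᴴ = 1 := Unitary.coe_mul_star_self _
  set N := Uᴴ * M with hN
  have hNN : N * Nᴴ = Matrix.diagonal fun i => (schmidt Ψ i : ℂ) := by
    have h := (reducedState_isHermitian Ψ).conjStarAlgAut_star_eigenvectorUnitary
    rw [Unitary.conjStarAlgAut_star_apply] at h
    nth_rewrite 2 [reducedState_eq] at h
    rw [hN, Matrix.conjTranspose_mul, Matrix.conjTranspose_conjTranspose]
    simp only [Matrix.mul_assoc] at h ⊢
    exact h
  have hN0 : ∀ i, schmidt Ψ i = 0 → ∀ b, N i b = 0 := by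
    intro i hi b
    have h := congrFun (congrFun hNN i) i
    rw [Matrix.diagonal_apply_eq, hi, Matrix.mul_apply] at h
    have h' : ∑ b, ‖N i b‖ ^ 2 = 0 := by
      have : ((∑ b, ‖N i b‖ ^ 2 : ℝ) : ℂ) = 0 := by
        rw [Complex.ofReal_zero] at h
        rw [← h]
        push_cast
        exact Finset.sum_congr rfl fun b _ => (Complex.mul_conj' _).symm
      exact_mod_cast this
    have := (Finset.sum_eq_zero_iff_of_nonneg fun b _ => by positivity).1 h' b (Finset.mem_univ b)
    simpa using this
  have hpos := nonzeroSchmidt_pos Ψ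
  have hsq : ∀ x, (√(nonzeroSchmidt Ψ x) : ℂ) ≠ 0 := fun x => by
    exact_mod_cast (Real.sqrt_pos.2 (hpos x)).ne'
  refine ⟨Matrix.of fun a x => U a x, Matrix.of fun b x => (√(nonzeroSchmidt Ψ x) : ℂ)⁻¹ * N x b,
    ?_, ?_, ?_⟩
  · ext x y
    have := congrFun (congrFun hUU x.1) y.1
    simp only [Matrix.mul_apply, Matrix.conjTranspose_apply, Matrix.one_apply] at this
    simp only [Matrix.mul_apply, Matrix.conjTranspose_apply, Matrix.of_apply, Matrix.one_apply,
      this, Subtype.ext_iff]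
  · ext x y
    have h := congrFun (congrFun hNN y.1) x.1
    simp only [Matrix.mul_apply, Matrix.conjTranspose_apply, Matrix.diagonal_apply] at h
    simp only [Matrix.mul_apply, Matrix.conjTranspose_apply, Matrix.of_apply, Matrix.one_apply]
    have e : ∀ b, star ((√(nonzeroSchmidt Ψ x) : ℂ)⁻¹ * N x b) *
        ((√(nonzeroSchmidt Ψ y) : ℂ)⁻¹ * N y b) =
        ((√(nonzeroSchmidt Ψ x) : ℂ)⁻¹ * (√(nonzeroSchmidt Ψ y) : ℂ)⁻¹) *
          (N y b * star (N x b)) := by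
      intro b
      simp only [star_mul', star_inv₀, Complex.star_def, Complex.conj_ofReal]
      ring
    simp_rw [e]
    rw [← Finset.mul_sum, h]
    by_cases hxy : x = y
    · subst hxy
      simp only [if_true]
      have : (schmidt Ψ x : ℂ) = √(nonzeroSchmidt Ψ x) * √(nonzeroSchmidt Ψ x) := by
        rw [← Complex.ofReal_mul, Real.mul_self_sqrt (hpos x).le]
        rfl
      rw [this]
      have := hsq x
      field_simp
    · have : (y : ι) ≠ x := fun h => hxy (Subtype.ext h.symm)
      simp [this, hxy]
  · rintro ⟨a, b⟩
    have h : M = U * N := by rw [hN, ← Matrix.mul_assoc, hUU', Matrix.one_mul]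
    have h' := congrFun (congrFun h a) b
    rw [Matrix.mul_apply] at h'
    change Ψ (a, b) = _ at h'
    rw [h', schmidtVec]
    rw [← Finset.sum_subset (Finset.subset_univ (Finset.univ.filter fun i => schmidt Ψ i ≠ 0)),
      Finset.sum_subtype (p := fun i => schmidt Ψ i ≠ 0) _ (by simp)]
    · refine Finset.sum_congr rfl fun x _ => ?_
      simp only [Matrix.of_apply]
      have := hsq x
      field_simp
    · intro i _ hi
      rw [hN0 i (by simpa using hi), mul_zero]

end Schmidt

/-! ### Tensor powers -/

section Copies

variable {ι κ X : Type} [Fintype ι] [Fintype κ] [Fintype X] [DecidableEq ι] [DecidableEq κ]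
  [DecidableEq X]

/-- The `n`-fold tensor power of a matrix. -/
def tensorPow (n : ℕ) (V : Matrix ι X ℂ) : Matrix (Fin n → ι) (Fin n → X) ℂ :=
  Matrix.of fun a x => ∏ k, V (a k) (x k)

theorem tensorPow_isometry {V : Matrix ι X ℂ} (hV : Vᴴ * V = 1) (n : ℕ) :
    (tensorPow n V)ᴴ * tensorPow n V = 1 := by
  ext x y
  simp only [Matrix.mul_apply, Matrix.conjTranspose_apply, tensorPow, Matrix.of_apply, star_prod,
    ← Finset.prod_mul_distrib]
  rw [← Fintype.piFinset_univ, ← Finset.prod_univ_sum (fun _ => Finset.univ)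
    fun k a => star (V a (x k)) * V a (y k)]
  have h : ∀ k, ∑ a, star (V a (x k)) * V a (y k) = if x k = y k then 1 else 0 := by
    intro k
    have := congrFun (congrFun hV (x k)) (y k)
    simpa [Matrix.mul_apply, Matrix.one_apply] using this
  simp_rw [h]
  rw [Finset.prod_ite_zero, Matrix.one_apply]
  simp [funext_iff]

theorem schmidtVec_tensorPow (V : Matrix ι X ℂ) (W : Matrix κ X ℂ) {lam : X → ℝ}
    (hlam : ∀ x, 0 < lam x) (n : ℕ) (p : (Fin n → ι) × (Fin n → κ)) :
    schmidtVec (tensorPow n V) (tensorPow n W) (fun x => √(prodWeight lam n x)) p =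
      ∏ k, schmidtVec V W (fun x => √(lam x)) (p.1 k, p.2 k) := by
  simp only [schmidtVec]
  rw [Finset.prod_univ_sum, Fintype.piFinset_univ]
  refine Finset.sum_congr rfl fun x _ => ?_
  have : √(prodWeight lam n x) = ∏ k, √(lam (x k)) := by
    rw [prodWeight, Real.sqrt_eq_rpow, ← Real.finsetProd_rpow _ _ fun k _ => (hlam _).le]
    simp_rw [Real.sqrt_eq_rpow]
  rw [this]
  simp [tensorPow, Finset.prod_mul_distrib]

theorem copies_pureState (n : ℕ) (Ψ : EuclideanSpace ℂ (ι × κ)) :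
    copies n (pureState Ψ) = Matrix.vecMulVec (fun p => ∏ k, Ψ (p.1 k, p.2 k))
      (star fun p => ∏ k, Ψ (p.1 k, p.2 k)) := by
  ext p q
  simp [copies, pureState, Matrix.vecMulVec_apply, Finset.prod_mul_distrib]

theorem trace_copies_mixedState {dA dB : ℕ} (n : ℕ)
    (E : Matrix ((Fin n → Fin dA) × (Fin n → Fin dB)) ((Fin n → Fin dA) × (Fin n → Fin dB)) ℂ) :
    (copies n (mixedState dA dB) * E).trace.re = (((dA : ℝ) * dB) ^ n)⁻¹ * E.trace.re := by
  have h : copies n (mixedState dA dB) = (((((dA : ℝ) * dB) ^ n)⁻¹ : ℝ) : ℂ) • 1 := by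
    ext p q
    simp only [copies, mixedState, Matrix.of_apply, Matrix.smul_apply, Matrix.one_apply,
      smul_eq_mul, mul_ite, mul_one, mul_zero]
    rw [Finset.prod_ite_zero]
    simp only [Finset.mem_univ, true_imp_iff, forall_and, Prod.ext_iff,
      funext_iff, Finset.prod_const, Finset.card_univ, Fintype.card_fin]
    push_cast
    rw [inv_pow]
  rw [h, Matrix.smul_mul, Matrix.one_mul, Matrix.trace_smul, smul_eq_mul, Complex.re_ofReal_mul]

end Copies

theorem tendsto_neg_inv_mul_log {β : ℕ → ℝ} {L : ℝ}
    (hlow : ∀ η > 0, ∀ᶠ n : ℕ in Filter.atTop, Real.exp (-(n * (L + η))) ≤ β n)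
    (hup : ∀ η > 0, ∀ᶠ n : ℕ in Filter.atTop, β n ≤ Real.exp (-(n * (L - η)))) :
    Filter.Tendsto (fun n : ℕ => -(1 / (n : ℝ)) * Real.log (β n)) Filter.atTop (nhds L) := by
  rw [Metric.tendsto_nhds]
  intro ε hε
  filter_upwards [hlow (ε / 2) (half_pos hε), hup (ε / 2) (half_pos hε),
    Filter.eventually_gt_atTop 0] with n h1 h2 hn
  have hn' : (0 : ℝ) < n := by exact_mod_cast hn
  have hβ : 0 < β n := (Real.exp_pos _).trans_le h1
  have l1 := (Real.le_log_iff_exp_le hβ).2 h1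
  have l2 := (Real.log_le_iff_le_exp hβ).2 h2
  have e : -(1 / (n : ℝ)) * Real.log (β n) = -Real.log (β n) / n := by ring
  rw [e, Real.dist_eq, abs_lt]
  constructor
  · rw [lt_sub_iff_add_lt, lt_div_iff₀ hn']
    nlinarith
  · rw [sub_lt_iff_lt_add, div_lt_iff₀ hn']
    nlinarith

variable {dA dB : ℕ}

/-- The vector `Ψ^{⊗ n}`. -/
def vecPow (Ψ : EuclideanSpace ℂ (Fin dA × Fin dB)) (n : ℕ) :
    (Fin n → Fin dA) × (Fin n → Fin dB) → ℂ :=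
  fun p => ∏ k, Ψ (p.1 k, p.2 k)

theorem dims_pos {Ψ : EuclideanSpace ℂ (Fin dA × Fin dB)} (hΨ : ‖Ψ‖ = 1) :
    (0 : ℝ) < (dA : ℝ) * dB := by
  have : Nonempty (Fin dA × Fin dB) := by
    by_contra h
    rw [not_nonempty_iff] at h
    have h0 : Ψ = 0 := Subsingleton.elim _ _
    rw [h0, norm_zero] at hΨ
    exact zero_ne_one hΨ
  obtain ⟨a, b⟩ := this
  have ha : 0 < dA := a.pos
  have hb : 0 < dB := b.pos
  positivity

/-- The rate of a class of tests from matching bounds on the trace of the accepting element. -/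
theorem tendsto_errorRate
    (C : ∀ (ι κ : Type) [Fintype ι] [DecidableEq ι] [Fintype κ] [DecidableEq κ],
      Set (Matrix (ι × κ) (ι × κ) ℂ))
    {Ψ : EuclideanSpace ℂ (Fin dA × Fin dB)} (hΨ : ‖Ψ‖ = 1) {r R : ℝ}
    (hconv : ∀ η > 0, ∀ᶠ n : ℕ in Filter.atTop, ∀ T ∈ C (Fin n → Fin dA) (Fin n → Fin dB),
      expect (vecPow Ψ n) T ≤ Real.exp (-(n * r)) →
        Real.exp (n * (R - η)) ≤ (1 - T).trace.re)
    (hach : ∀ η > 0, ∀ᶠ n : ℕ in Filter.atTop, ∃ T ∈ C (Fin n → Fin dA) (Fin n → Fin dB),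
      expect (vecPow Ψ n) T ≤ Real.exp (-(n * r)) ∧
        (1 - T).trace.re ≤ Real.exp (n * (R + η))) :
    Filter.Tendsto (errorRate C r Ψ) Filter.atTop (nhds (Real.log ((dA : ℝ) * dB) - R)) := by
  have hd := dims_pos hΨ
  have hdn : ∀ n : ℕ, (((dA : ℝ) * dB) ^ n)⁻¹ = Real.exp (-(n * Real.log ((dA : ℝ) * dB))) := by
    intro n
    rw [Real.exp_neg, Real.exp_nat_mul, Real.exp_log hd]
  have hset : ∀ n : ℕ, ∀ T, ((copies n (pureState Ψ) * T).trace.re) = expect (vecPow Ψ n) T := by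
    intro n T
    rw [copies_pureState, trace_pure_mul]
    rfl
  have hlow : ∀ η > 0, ∀ᶠ n : ℕ in Filter.atTop,
      ∀ b ∈ {b | ∃ T ∈ C (Fin n → Fin dA) (Fin n → Fin dB),
        (copies n (pureState Ψ) * T).trace.re ≤ Real.exp (-(n * r)) ∧
          b = (copies n (mixedState dA dB) * (1 - T)).trace.re},
      Real.exp (-(n * (Real.log ((dA : ℝ) * dB) - R + η))) ≤ b := by
    intro η hη
    filter_upwards [hconv η hη] with n hn
    rintro b ⟨T, hT, h1, rfl⟩
    rw [hset] at h1
    rw [trace_copies_mixedState, hdn]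
    have := hn T hT h1
    calc Real.exp (-(n * (Real.log ((dA : ℝ) * dB) - R + η)))
        = Real.exp (-(n * Real.log ((dA : ℝ) * dB))) * Real.exp (n * (R - η)) := by
          rw [← Real.exp_add]; congr 1; ring
      _ ≤ _ := by gcongr
  refine tendsto_neg_inv_mul_log (fun η hη => ?_) (fun η hη => ?_)
  · filter_upwards [hlow η hη, hach η hη] with n h1 h2
    obtain ⟨T, hT, h3, -⟩ := h2
    exact le_csInf ⟨_, T, hT, (hset n T).trans_le h3, rfl⟩ h1
  -- The converse is reused here to bound the set of errors from below, without which its infimum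
  -- would not be controlled.
  · filter_upwards [hlow η hη, hach η hη] with n h1 h2
    obtain ⟨T, hT, h3, h4⟩ := h2
    refine (csInf_le ⟨_, h1⟩ ⟨T, hT, (hset n T).trans_le h3, rfl⟩).trans ?_
    rw [trace_copies_mixedState, hdn]
    calc _ ≤ Real.exp (-(n * Real.log ((dA : ℝ) * dB))) * Real.exp (n * (R + η)) := by gcongr
      _ = _ := by rw [← Real.exp_add]; congr 1; ring

theorem vecPow_eq {Ψ : EuclideanSpace ℂ (Fin dA × Fin dB)}
    {V : Matrix (Fin dA) {i // schmidt Ψ i ≠ 0} ℂ} {W : Matrix (Fin dB) {i // schmidt Ψ i ≠ 0} ℂ}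
    (hΨ : ∀ p, Ψ p = schmidtVec V W (fun x => √(nonzeroSchmidt Ψ x)) p) (n : ℕ) :
    vecPow Ψ n = schmidtVec (tensorPow n V) (tensorPow n W)
      (fun x => √(prodWeight (nonzeroSchmidt Ψ) n x)) := by
  ext p
  rw [schmidtVec_tensorPow V W (nonzeroSchmidt_pos Ψ)]
  simp only [vecPow, hΨ]

theorem nonempty_nonzeroSchmidt {Ψ : EuclideanSpace ℂ (Fin dA × Fin dB)} (hΨ : ‖Ψ‖ = 1) :
    Nonempty {i // schmidt Ψ i ≠ 0} := by
  by_contra h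
  rw [not_nonempty_iff] at h
  have := sum_nonzeroSchmidt hΨ
  simp at this

theorem hoeffdingBound_eq {Ψ : EuclideanSpace ℂ (Fin dA × Fin dB)} (hΨ : ‖Ψ‖ = 1) {r θ₀ : ℝ}
    (h : IsCritical (nonzeroSchmidt Ψ) (1 / 2) r θ₀) :
    hoeffdingBound r Ψ = Real.log ((dA : ℝ) * dB) -
      (tiltedEntropy (nonzeroSchmidt Ψ) θ₀ - tiltedDivergence (nonzeroSchmidt Ψ) θ₀) := by
  have := nonempty_nonzeroSchmidt hΨ
  have hg := (isGreatest_hoeffding (nonzeroSchmidt_pos Ψ) h).csSup_eq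
  have he : ∀ α, renyiEntropy α Ψ = Real.log (powSum (nonzeroSchmidt Ψ) α) / (1 - α) := by
    intro α
    rw [renyiEntropy, powSum, sum_nonzeroSchmidt_comp Ψ fun v => v ^ α]
  simp only [hoeffdingBound, he]
  rw [hg]
  ring

/-! ### Rates of the test classes -/

section Rates

variable {Ψ : EuclideanSpace ℂ (Fin dA × Fin dB)}

theorem eventually_exists_roundTwo (hΨ : ‖Ψ‖ = 1) {r θ₀ : ℝ} (hr : 0 < r)
    (h : IsCritical (nonzeroSchmidt Ψ) (1 / 2) r θ₀) {η : ℝ} (hη : 0 < η) :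
    ∀ᶠ n : ℕ in Filter.atTop, ∃ T ∈ roundLOCC (Fin n → Fin dA) (Fin n → Fin dB) 2,
      expect (vecPow Ψ n) T ≤ Real.exp (-(n * r)) ∧
      (1 - T).trace.re ≤ Real.exp (n * (tiltedEntropy (nonzeroSchmidt Ψ) θ₀ -
        tiltedDivergence (nonzeroSchmidt Ψ) θ₀ + η)) := by
  have := nonempty_nonzeroSchmidt hΨ
  obtain ⟨V, W, hV, hW, hVW⟩ := exists_schmidt_decomposition Ψ
  set lam := nonzeroSchmidt Ψ with hlamdef
  have hlam : ∀ x, 0 < lam x := nonzeroSchmidt_pos Ψ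
  have hsum : ∑ x, lam x = 1 := sum_nonzeroSchmidt hΨ
  filter_upwards [eventually_exp_neg_le hr (show (0 : ℝ) < 1 / 2 by norm_num),
    eventually_poly_le_exp (Fintype.card {i // schmidt Ψ i ≠ 0}) hη] with n hn hpoly
  obtain ⟨Y, hY1, hY2⟩ := exists_cutoff hlam h n
  have hsplit := Finset.sum_add_sum_compl Y (prodWeight lam n)
  rw [sum_prodWeight hsum] at hsplit
  have hYne : Y.Nonempty := by
    rw [Finset.nonempty_iff_ne_empty]
    rintro rfl
    rw [Finset.sum_empty] at hsplit
    linarith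
  obtain ⟨T, hT, htr, hex⟩ := exists_roundTwo_test_le (tensorPow_isometry hV n)
    (tensorPow_isometry hW n) (prodWeight_pos hlam n) hYne
  rw [← vecPow_eq hVW, expect_sub, vecPow_eq hVW,
    expect_one (tensorPow_isometry hV n) (tensorPow_isometry hW n), ← vecPow_eq hVW,
    ← hlamdef] at hex
  simp only [fun x => Real.sq_sqrt (prodWeight_pos hlam n x).le] at hex
  rw [sum_prodWeight hsum] at hex
  refine ⟨T, hT, by linarith, htr.trans ?_⟩
  have hp : (1 : ℝ) / 2 ≤ ∑ x ∈ Y, prodWeight lam n x := by linarith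
  have hR0 : 0 ≤ ∑ x ∈ Y, √(prodWeight lam n x) :=
    Finset.sum_nonneg fun x _ => Real.sqrt_nonneg _
  simp_rw [← Real.sqrt_eq_rpow] at hY2
  -- The exponent is `2 log ∑ λ^θ₀ + (2θ₀ - 1) u(θ₀) = H(θ₀) - D(θ₀)`, from the cutoff with `a =
  -- 1/2`.
  have hR2 : (∑ x ∈ Y, √(prodWeight lam n x)) ^ 2 ≤
      Real.exp (n * (tiltedEntropy lam θ₀ - tiltedDivergence lam θ₀)) := by
    refine (pow_le_pow_left₀ hR0 hY2 2).trans (le_of_eq ?_)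
    rw [← Real.exp_nat_mul, tiltedEntropy, tiltedDivergence]
    congr 1
    push_cast
    ring
  have hc : ((Y.image (prodWeight lam n)).card : ℝ) ≤
      ((n : ℝ) + 1) ^ Fintype.card {i // schmidt Ψ i ≠ 0} := by
    exact_mod_cast card_image_prodWeight_le n Y
  rw [div_le_iff₀ (by linarith)]
  calc (1 + ((Y.image (prodWeight lam n)).card : ℝ)) * (∑ x ∈ Y, √(prodWeight lam n x)) ^ 2
      ≤ (1 + ((n : ℝ) + 1) ^ Fintype.card {i // schmidt Ψ i ≠ 0}) *
        Real.exp (n * (tiltedEntropy lam θ₀ - tiltedDivergence lam θ₀)) := by gcongr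
    _ ≤ (Real.exp (n * η) * (1 / 2)) *
        Real.exp (n * (tiltedEntropy lam θ₀ - tiltedDivergence lam θ₀)) := by
        gcongr
        linarith
    _ = Real.exp (n * (tiltedEntropy lam θ₀ - tiltedDivergence lam θ₀ + η)) * (1 / 2) := by
        rw [mul_add, Real.exp_add]; ring
    _ ≤ _ := by gcongr

theorem eventually_exists_oneWay (hΨ : ‖Ψ‖ = 1) {r θ₀ : ℝ}
    (h : IsCritical (nonzeroSchmidt Ψ) 0 r θ₀) {η : ℝ} (hη : 0 < η) :
    ∀ᶠ n : ℕ in Filter.atTop, ∃ T ∈ oneWayLOCC (Fin n → Fin dA) (Fin n → Fin dB),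
      expect (vecPow Ψ n) T ≤ Real.exp (-(n * r)) ∧
      (1 - T).trace.re ≤ Real.exp (n * (tiltedEntropy (nonzeroSchmidt Ψ) θ₀ + η)) := by
  have := nonempty_nonzeroSchmidt hΨ
  obtain ⟨V, W, hV, hW, hVW⟩ := exists_schmidt_decomposition Ψ
  set lam := nonzeroSchmidt Ψ with hlamdef
  have hlam : ∀ x, 0 < lam x := nonzeroSchmidt_pos Ψ
  have hsum : ∑ x, lam x = 1 := sum_nonzeroSchmidt hΨ
  refine Filter.Eventually.of_forall fun n => ?_
  obtain ⟨Y, hY1, hY2⟩ := exists_cutoff hlam h n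
  have hsplit := Finset.sum_add_sum_compl Y (prodWeight lam n)
  rw [sum_prodWeight hsum] at hsplit
  obtain ⟨T, hT, htr, hex⟩ := exists_oneWay_test (tensorPow_isometry hV n)
    (tensorPow_isometry hW n) (prodWeight_pos hlam n) Y
  rw [← vecPow_eq hVW, expect_sub, vecPow_eq hVW,
    expect_one (tensorPow_isometry hV n) (tensorPow_isometry hW n), ← vecPow_eq hVW,
    ← hlamdef] at hex
  simp only [fun x => Real.sq_sqrt (prodWeight_pos hlam n x).le] at hex
  rw [sum_prodWeight hsum] at hex
  refine ⟨T, hT, by linarith, ?_⟩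
  rw [htr]
  simp only [Real.rpow_zero, Finset.sum_const, nsmul_eq_mul, mul_one] at hY2
  refine hY2.trans (Real.exp_le_exp.2 (mul_le_mul_of_nonneg_left ?_ (Nat.cast_nonneg n)))
  rw [tiltedEntropy]
  linarith

theorem eventually_twoWay_converse (hΨ : ‖Ψ‖ = 1) {r θ₀ : ℝ}
    (h : IsCritical (nonzeroSchmidt Ψ) (1 / 2) r θ₀) {η : ℝ} (hη : 0 < η) :
    ∀ᶠ n : ℕ in Filter.atTop, ∀ T ∈ twoWayLOCC (Fin n → Fin dA) (Fin n → Fin dB) ∪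
        separablePOVM (Fin n → Fin dA) (Fin n → Fin dB),
      expect (vecPow Ψ n) T ≤ Real.exp (-(n * r)) →
        Real.exp (n * (tiltedEntropy (nonzeroSchmidt Ψ) θ₀ -
          tiltedDivergence (nonzeroSchmidt Ψ) θ₀ - η)) ≤ (1 - T).trace.re := by
  have := nonempty_nonzeroSchmidt hΨ
  obtain ⟨V, W, hV, hW, hVW⟩ := exists_schmidt_decomposition Ψ
  have hlam := nonzeroSchmidt_pos Ψ
  filter_upwards [eventually_le_of_sum_sqrt_le hlam h hη] with n hn T hT hTe
  refine hn _ _ hTe fun S => ?_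
  rw [vecPow_eq hVW]
  rcases hT with hT | ⟨h1, h2⟩
  · exact sum_sqrt_le_of_mem_twoWayLOCC (tensorPow_isometry hV n) (tensorPow_isometry hW n)
      (prodWeight_pos hlam n) (sum_prodWeight (sum_nonzeroSchmidt hΨ) n) hT S
  · exact sum_sqrt_le_of_isSeparable (tensorPow_isometry hV n) (tensorPow_isometry hW n)
      (prodWeight_pos hlam n) (sum_prodWeight (sum_nonzeroSchmidt hΨ) n) h1 h2 S

theorem eventually_oneWay_converse (hΨ : ‖Ψ‖ = 1) {r θ₀ : ℝ}
    (h : IsCritical (nonzeroSchmidt Ψ) 0 r θ₀) {η : ℝ} (hη : 0 < η) :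
    ∀ᶠ n : ℕ in Filter.atTop, ∀ T ∈ oneWayLOCC (Fin n → Fin dA) (Fin n → Fin dB),
      expect (vecPow Ψ n) T ≤ Real.exp (-(n * r)) →
        Real.exp (n * (tiltedEntropy (nonzeroSchmidt Ψ) θ₀ - η)) ≤ (1 - T).trace.re := by
  have := nonempty_nonzeroSchmidt hΨ
  obtain ⟨V, W, hV, hW, hVW⟩ := exists_schmidt_decomposition Ψ
  have hlam := nonzeroSchmidt_pos Ψ
  filter_upwards [eventually_le_of_classical_test hlam h hη] with n hn T hT hTe
  obtain ⟨t, h0, h1, h2, h3⟩ := exists_classical_test_of_oneWay (tensorPow_isometry hV n)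
    (tensorPow_isometry hW n) (prodWeight_pos hlam n)
    (sum_prodWeight (sum_nonzeroSchmidt hΨ) n) hT
  rw [← vecPow_eq hVW] at h3
  exact (hn t h0 h1 (h3.trans hTe)).trans h2

theorem roundLOCC_subset_separablePOVM (ι κ : Type) [Fintype ι] [DecidableEq ι] [Fintype κ]
    [DecidableEq κ] (k : ℕ) : roundLOCC ι κ k ⊆ separablePOVM ι κ :=
  fun T hT => IsLOCC.isSeparable k ι κ T hT

theorem roundLOCC_subset_twoWayLOCC (ι κ : Type) [Fintype ι] [DecidableEq ι] [Fintype κ]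
    [DecidableEq κ] (k : ℕ) : roundLOCC ι κ k ⊆ twoWayLOCC ι κ :=
  (Set.subset_iUnion (roundLOCC ι κ) k).trans subset_closure

/-- The rate of every class between two-round LOCC and separable or two-way LOCC tests. -/
theorem tendsto_errorRate_of_between
    (C : ∀ (ι κ : Type) [Fintype ι] [DecidableEq ι] [Fintype κ] [DecidableEq κ],
      Set (Matrix (ι × κ) (ι × κ) ℂ))
    (hlow : ∀ n, roundLOCC (Fin n → Fin dA) (Fin n → Fin dB) 2 ⊆
      C (Fin n → Fin dA) (Fin n → Fin dB))
    (hup : ∀ n, C (Fin n → Fin dA) (Fin n → Fin dB) ⊆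
      twoWayLOCC (Fin n → Fin dA) (Fin n → Fin dB) ∪
        separablePOVM (Fin n → Fin dA) (Fin n → Fin dB))
    (hΨ : ‖Ψ‖ = 1) {r θ₀ : ℝ} (hr : 0 < r)
    (h : IsCritical (nonzeroSchmidt Ψ) (1 / 2) r θ₀) :
    Filter.Tendsto (errorRate C r Ψ) Filter.atTop (nhds (hoeffdingBound r Ψ)) := by
  rw [hoeffdingBound_eq hΨ h]
  refine tendsto_errorRate C hΨ (fun η hη => ?_) (fun η hη => ?_)
  · filter_upwards [eventually_twoWay_converse hΨ h hη] with n hn T hT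
    exact hn T (hup n hT)
  · filter_upwards [eventually_exists_roundTwo hΨ hr h hη] with n hn
    obtain ⟨T, hT, h'⟩ := hn
    exact ⟨T, hlow n hT, h'⟩

end Rates

end

end LocalTesting

theorem mainTheorem2 {dA dB : ℕ} (Ψ : EuclideanSpace ℂ (Fin dA × Fin dB)) (hΨ : ‖Ψ‖ = 1)
    (r : ℝ) (hr : 0 < r) :
    Filter.Tendsto
      (LocalTesting.errorRate (fun ι κ _ _ _ _ => LocalTesting.roundLOCC ι κ 2) r Ψ)
      Filter.atTop (nhds (LocalTesting.hoeffdingBound r Ψ)) ∧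
    Filter.Tendsto
      (LocalTesting.errorRate (fun ι κ _ _ _ _ => LocalTesting.twoWayLOCC ι κ) r Ψ)
      Filter.atTop (nhds (LocalTesting.hoeffdingBound r Ψ)) ∧
    Filter.Tendsto
      (LocalTesting.errorRate (fun ι κ _ _ _ _ => LocalTesting.separablePOVM ι κ) r Ψ)
      Filter.atTop (nhds (LocalTesting.hoeffdingBound r Ψ)) ∧
    ∃ h : ℝ,
      Filter.Tendsto
        (LocalTesting.errorRate (fun ι κ _ _ _ _ => LocalTesting.oneWayLOCC ι κ) r Ψ)
        Filter.atTop (nhds h) ∧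
      (h < LocalTesting.hoeffdingBound r Ψ ↔ ¬ LocalTesting.IsFlat Ψ) := by
  open LocalTesting in
  have := nonempty_nonzeroSchmidt hΨ
  have hlam := nonzeroSchmidt_pos Ψ
  have hsum := sum_nonzeroSchmidt hΨ
  obtain ⟨θ₂, h₂⟩ := exists_isCritical hlam hsum (a := 1 / 2) (by norm_num) hr
  obtain ⟨θ₁, h₁⟩ := exists_isCritical hlam hsum (a := 0) one_pos hr
  refine ⟨tendsto_errorRate_of_between (fun ι κ _ _ _ _ => roundLOCC ι κ 2)
      (fun n => subset_rfl)
      (fun n => (roundLOCC_subset_separablePOVM _ _ 2).trans Set.subset_union_right) hΨ hr h₂,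
    tendsto_errorRate_of_between (fun ι κ _ _ _ _ => twoWayLOCC ι κ)
      (fun n => roundLOCC_subset_twoWayLOCC _ _ 2) (fun n => Set.subset_union_left) hΨ hr h₂,
    tendsto_errorRate_of_between (fun ι κ _ _ _ _ => separablePOVM ι κ)
      (fun n => roundLOCC_subset_separablePOVM _ _ 2) (fun n => Set.subset_union_right) hΨ hr h₂,
    Real.log ((dA : ℝ) * dB) - tiltedEntropy (nonzeroSchmidt Ψ) θ₁,
    tendsto_errorRate (fun ι κ _ _ _ _ => oneWayLOCC ι κ) hΨ
      (fun η hη => eventually_oneWay_converse hΨ h₁ hη)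
      (fun η hη => eventually_exists_oneWay hΨ h₁ hη), ?_⟩
  rw [hoeffdingBound_eq hΨ h₂]
  -- Beyond `θ₂` the divergence is below `r`, so a larger `θ₁` would have to be the endpoint `0`,
  -- contradicting `θ₂ ≥ 1/2`.
  have hle : θ₁ ≤ θ₂ := by
    by_contra! hlt
    have hD := h₂.2.2.2 θ₁ hlt h₁.2.1
    rcases h₁.2.2.1 with h | ⟨h, -⟩
    · linarith
    · have := h₂.1
      linarith
  have hH := tiltedEntropy_antitoneOn hlam h₁.1 hle
  constructor
  · intro hlt hflat
    have hf : ∀ x y, nonzeroSchmidt Ψ x = nonzeroSchmidt Ψ y := fun x y => hflat _ _ x.2 y.2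
    rw [tiltedEntropy_of_flat hlam hf, tiltedEntropy_of_flat hlam hf,
      tiltedDivergence_of_flat hlam hsum hf] at hlt
    linarith
  · intro hflat
    have hf : ∃ x y, nonzeroSchmidt Ψ x ≠ nonzeroSchmidt Ψ y := by
      by_contra! hc
      exact hflat fun i j hi hj => hc ⟨i, hi⟩ ⟨j, hj⟩
    have := tiltedDivergence_pos hlam hsum hf h₂.2.1
    linarith
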